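/- Fix constants $K>0$ and $\varepsilon>0$. For each $n\ge 1$ let $\xi_{ij}=\xi^{(n)}_{ij}$, $1\le i,j\le n$, be independent (not necessarily identically distributed) real random variables, each with mean $0$ and variance $1$, and with $|\xi_{ij}|\le K$ almost surely, where $K$ does not depend on $n$. Let $M_n=(\xi_{ij})_{1\le i,j\le n}$. Then $$\mathbf P\Bigl(|\det M_n|\ \ge\ \sqrt{n!}\,\exp\bigl(-n^{1/2+\varepsilon}\bigr)\Bigr)\ \ge\ 1-o(1)\qquad (n\to\infty),$$ where $o(1)$ denotes a quantity that tends to $0$ as $n\to\infty$ and depends only on $n$, $K$ and $\varepsilon$ (not on the distributions of the entries). -/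

import Mathlib

open MeasureTheory ProbabilityTheory Filter Topology
open scoped Nat

section Resampling

variable {ι : Type*} [Fintype ι] [DecidableEq ι] {X : ι → Type*} [∀ i, MeasurableSpace (X i)]
  (μ : ∀ i, Measure (X i)) [∀ i, IsProbabilityMeasure (μ i)]

open scoped ENNReal

/-- Resampling one coordinate of a product probability measure does not change integrals. -/
theorem lintegral_pi_update {f : (∀ i, X i) → ℝ≥0∞} (hf : Measurable f) (i : ι) :
    ∫⁻ x, f x ∂Measure.pi μ =
      ∫⁻ x, ∫⁻ y, f (Function.update x i y) ∂μ i ∂Measure.pi μ := by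
  have hg : (fun x => ∫⁻ y, f (Function.update x i y) ∂μ i) = ∫⋯∫⁻_{i}, f ∂μ := by
    rw [lmarginal_singleton]
  have hm : Measurable (fun x => ∫⁻ y, f (Function.update x i y) ∂μ i) := by
    rw [hg]; exact hf.lmarginal μ
  refine lintegral_eq_of_lmarginal_eq {i} hf hm ?_
  rw [lmarginal_singleton, lmarginal_singleton]
  ext x
  simp

theorem lintegral_pi_le_of_update {f : (∀ i, X i) → ℝ≥0∞} (hf : Measurable f) (i : ι)
    {c : ℝ≥0∞} (h : ∀ x, ∫⁻ y, f (Function.update x i y) ∂μ i ≤ c) :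
    ∫⁻ x, f x ∂Measure.pi μ ≤ c := by
  rw [lintegral_pi_update μ hf i]
  calc _ ≤ ∫⁻ _, c ∂Measure.pi μ := lintegral_mono h
    _ = c := by simp

/-- If `E` does not depend on coordinate `i` and, on `E`, the conditional probability of `G` given
the other coordinates is at most `p`, then `μ (E ∩ G) ≤ p * μ E`. -/
theorem measure_pi_inter_le_mul {E G : Set (∀ i, X i)} (hE : MeasurableSet E)
    (hG : MeasurableSet G) (i : ι) (hEi : ∀ x y, Function.update x i y ∈ E ↔ x ∈ E) {p : ℝ≥0∞}
    (h : ∀ x ∈ E, μ i {y | Function.update x i y ∈ G} ≤ p) :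
    Measure.pi μ (E ∩ G) ≤ p * Measure.pi μ E := by
  rw [← lintegral_indicator_one (hE.inter hG),
    lintegral_pi_update μ (measurable_one.indicator (hE.inter hG)) i,
    ← lintegral_indicator_one hE, ← lintegral_const_mul _ (measurable_one.indicator hE)]
  refine lintegral_mono fun x => ?_
  by_cases hx : x ∈ E
  · have : (fun y => (E ∩ G).indicator (1 : (∀ i, X i) → ℝ≥0∞) (Function.update x i y)) =
        {y | Function.update x i y ∈ G}.indicator 1 := by
      funext y
      by_cases hy : Function.update x i y ∈ G <;> simp [hEi, hx, hy]
    simp only [this]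
    rw [lintegral_indicator_one (s := {y | Function.update x i y ∈ G}) (measurable_update x hG)]
    simpa [hx] using h x hx
  · simp [hEi, hx]

end Resampling

/-- The normalisation of the entries: mean `0`, variance `1`, bounded by `K`. -/
structure IsStdBounded (K : ℝ) (ν : Measure ℝ) : Prop where
  bound : ∀ᵐ x ∂ν, |x| ≤ K
  mean : ∫ x, x ∂ν = 0
  second : ∫ x, x ^ 2 ∂ν = 1

namespace IsStdBounded

variable {K : ℝ} {ν : Measure ℝ} [IsProbabilityMeasure ν]

theorem integrable (h : IsStdBounded K ν) {f : ℝ → ℝ} (hf : Continuous f) : Integrable f ν := by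
  obtain ⟨C, hC⟩ := (isCompact_Icc (a := -K) (b := K)).exists_bound_of_continuousOn hf.continuousOn
  refine Integrable.of_bound hf.aestronglyMeasurable C ?_
  filter_upwards [h.bound] with x hx
  exact hC x (abs_le.1 hx)

theorem nonneg (h : IsStdBounded K ν) : 0 ≤ K := by
  obtain ⟨x, hx⟩ := h.bound.exists
  exact (abs_nonneg x).trans hx

theorem one_le_sq (h : IsStdBounded K ν) : 1 ≤ K ^ 2 := by
  have : ∫ x, x ^ 2 ∂ν ≤ ∫ _, K ^ 2 ∂ν := by
    refine integral_mono_ae (h.integrable (by fun_prop)) (integrable_const _) ?_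
    filter_upwards [h.bound] with x hx
    exact sq_le_sq' (by linarith [abs_le.1 hx]) (abs_le.1 hx).2
  simpa [h.second] using this

theorem one_le (h : IsStdBounded K ν) : 1 ≤ K := by
  nlinarith [h.one_le_sq, h.nonneg]

theorem integral_sq_sub_one (h : IsStdBounded K ν) : ∫ x, (x ^ 2 - 1) ∂ν = 0 := by
  rw [integral_sub (h.integrable (by fun_prop)) (integrable_const _), h.second]
  simp

theorem integral_sq_sub_one_sq_le (h : IsStdBounded K ν) : ∫ x, (x ^ 2 - 1) ^ 2 ∂ν ≤ K ^ 2 := by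
  have : ∫ x, (x ^ 2 - 1) ^ 2 ∂ν ≤ ∫ x, ((K ^ 2 - 2) * x ^ 2 + 1) ∂ν := by
    refine integral_mono_ae (h.integrable (by fun_prop)) (h.integrable (by fun_prop)) ?_
    filter_upwards [h.bound] with x hx
    have h1 : x ^ 2 ≤ K ^ 2 := sq_le_sq' (by linarith [abs_le.1 hx]) (abs_le.1 hx).2
    show (x ^ 2 - 1) ^ 2 ≤ (K ^ 2 - 2) * x ^ 2 + 1
    nlinarith [sq_nonneg x]
  rw [integral_add (h.integrable (by fun_prop)) (integrable_const _), integral_const_mul,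
    h.second] at this
  simp at this
  linarith

/-- A standardised bounded variable is not concentrated near any point. -/
theorem measureReal_abs_sub_le (h : IsStdBounded K ν) (x : ℝ) :
    ν.real {y | |y - x| ≤ 1 / 2} ≤ 1 - 3 / (8 * K ^ 2) := by
  set A : Set ℝ := {y | |y - x| ≤ 1 / 2} with hA
  have hAm : MeasurableSet A := measurableSet_le (by fun_prop) (by fun_prop)
  have hK := h.one_le
  have h1 : ∫ y, (y - x) ^ 2 ∂ν = 1 + x ^ 2 := by
    have : ∀ y : ℝ, (y - x) ^ 2 = (y ^ 2 + (-2 * x) * y) + x ^ 2 := fun y => by ring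
    simp_rw [this]
    rw [integral_add (h.integrable (by fun_prop)) (integrable_const _),
      integral_add (h.integrable (by fun_prop)) (h.integrable (by fun_prop)), integral_const_mul,
      h.second, h.mean]
    simp
  have h2 : ∫ y, (y - x) ^ 2 ∂ν ≤
      ∫ y, (1 / 4 + Aᶜ.indicator (fun _ => (K + |x|) ^ 2) y) ∂ν := by
    refine integral_mono_ae (h.integrable (by fun_prop))
      ((integrable_const _).add ((integrable_const _).indicator hAm.compl)) ?_
    filter_upwards [h.bound] with y hy
    by_cases hyA : y ∈ A
    · have : |y - x| ≤ 1 / 2 := hyA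
      simp only [Set.indicator_apply, Set.mem_compl_iff, hyA]
      have hs := pow_le_pow_left₀ (abs_nonneg _) this 2
      rw [sq_abs] at hs
      norm_num at hs ⊢
      linarith
    · simp only [Set.indicator_apply, Set.mem_compl_iff, hyA]
      have : |y - x| ≤ K + |x| := (abs_sub y x).trans (by linarith)
      have hs := pow_le_pow_left₀ (abs_nonneg _) this 2
      rw [sq_abs] at hs
      norm_num at hs ⊢
      linarith
  rw [integral_add (integrable_const _) ((integrable_const _).indicator hAm.compl),
    integral_indicator_const _ hAm.compl, h1, probReal_compl_eq_one_sub hAm] at h2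
  simp only [integral_const, probReal_univ, smul_eq_mul, one_mul] at h2
  have hp : 0 ≤ 1 - ν.real A := by linarith [measureReal_le_one (μ := ν) (s := A)]
  have h3 : (K + |x|) ^ 2 ≤ 2 * (K ^ 2 + x ^ 2) := by
    nlinarith [sq_nonneg (K - |x|), sq_abs x]
  have h4 : 3 / 4 + x ^ 2 ≤ (1 - ν.real A) * (2 * (K ^ 2 + x ^ 2)) := by
    nlinarith [mul_le_mul_of_nonneg_left h3 hp]
  have h5 : 3 / (8 * K ^ 2) * (2 * (K ^ 2 + x ^ 2)) ≤ 3 / 4 + x ^ 2 := by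
    have : 3 / (8 * K ^ 2) * (2 * (K ^ 2 + x ^ 2)) = 3 / 4 + 3 / (4 * K ^ 2) * x ^ 2 := by
      field_simp; ring
    rw [this]
    have : 3 / (4 * K ^ 2) ≤ 1 := by
      rw [div_le_one (by positivity)]; nlinarith
    nlinarith [sq_nonneg x]
  have h6 : 3 / (8 * K ^ 2) ≤ 1 - ν.real A := by
    by_contra! hlt
    have : 0 < 2 * (K ^ 2 + x ^ 2) := by positivity
    nlinarith
  linarith

end IsStdBounded

/-- The factor at coordinate `m` of the degree two orthogonal polynomial indexed by `p`. -/
noncomputable def chaosFactor {n : ℕ} (p : Fin n × Fin n) (m : Fin n) (x : ℝ) : ℝ :=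
  if p.1 = m then (if p.2 = m then x ^ 2 - 1 else x) else if p.2 = m then x else 1

/-- The polynomials `x i * x j` and `x i ^ 2 - 1`, orthogonal for standardised product measures. -/
noncomputable def chaos {n : ℕ} (p : Fin n × Fin n) (x : Fin n → ℝ) : ℝ :=
  ∏ m, chaosFactor p m (x m)

section Chaos

variable {n : ℕ}

theorem chaos_of_eq {p : Fin n × Fin n} (hp : p.1 = p.2) (x : Fin n → ℝ) :
    chaos p x = x p.1 * x p.2 - 1 := by
  rw [chaos, Finset.prod_eq_single p.1]
  · simp [chaosFactor, ← hp, sq]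
  · intro m _ hm
    simp [chaosFactor, ← hp, hm.symm]
  · simp

theorem chaos_of_ne {p : Fin n × Fin n} (hp : p.1 ≠ p.2) (x : Fin n → ℝ) :
    chaos p x = x p.1 * x p.2 := by
  rw [chaos, Finset.prod_eq_mul p.1 p.2 hp]
  · simp [chaosFactor, hp, hp.symm]
  · intro m _ hm
    simp [chaosFactor, hm.1.symm, hm.2.symm]
  · simp
  · simp

theorem continuous_chaosFactor (p : Fin n × Fin n) (m : Fin n) : Continuous (chaosFactor p m) := by
  unfold chaosFactor
  split_ifs <;> fun_prop

theorem exists_chaosFactor_integral_eq_zero {K : ℝ} {ν : Fin n → Measure ℝ}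
    [∀ j, IsProbabilityMeasure (ν j)] (hν : ∀ j, IsStdBounded K (ν j)) {p q : Fin n × Fin n}
    (hp : p.1 ≤ p.2) (hq : q.1 ≤ q.2) (hpq : p ≠ q) :
    ∃ m, ∫ x, chaosFactor p m x * chaosFactor q m x ∂ν m = 0 := by
  have key : ∀ (p q : Fin n × Fin n) (m : Fin n), (p.1 = m ∨ p.2 = m) → q.1 ≠ m → q.2 ≠ m →
      ∫ x, chaosFactor p m x * chaosFactor q m x ∂ν m = 0 := by
    intro p q m h h1 h2
    by_cases h3 : p.1 = m <;> by_cases h4 : p.2 = m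
    · simpa [chaosFactor, h1, h2, h3, h4] using (hν m).integral_sq_sub_one
    · simpa [chaosFactor, h1, h2, h3, h4] using (hν m).mean
    · simpa [chaosFactor, h1, h2, h3, h4] using (hν m).mean
    · tauto
  have key' : ∀ (m : Fin n), (q.1 = m ∨ q.2 = m) → p.1 ≠ m → p.2 ≠ m →
      ∫ x, chaosFactor p m x * chaosFactor q m x ∂ν m = 0 := by
    intro m h h1 h2
    simp_rw [mul_comm (chaosFactor p m _)]
    exact key q p m h h1 h2
  obtain ⟨i, j⟩ := p
  obtain ⟨k, l⟩ := q
  simp only at *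
  by_contra! hne
  have a1 := fun h1 h2 => hne i (key (i, j) (k, l) i (Or.inl rfl) h1 h2)
  have a2 := fun h1 h2 => hne j (key (i, j) (k, l) j (Or.inr rfl) h1 h2)
  have a3 := fun h1 h2 => hne k (key' k (Or.inl rfl) h1 h2)
  have a4 := fun h1 h2 => hne l (key' l (Or.inr rfl) h1 h2)
  simp only [ne_eq, Prod.mk.injEq, imp_false, not_not] at *
  apply hpq
  by_cases e1 : k = i
  · subst e1
    by_cases e2 : k = j
    · subst e2
      refine ⟨rfl, ?_⟩
      by_contra h
      exact h (a4 h)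
    · refine ⟨rfl, ?_⟩
      exact (a2 e2).symm
  · have e2 := a1 e1
    subst e2
    have : j = k := by
      by_contra h
      exact h (a3 (Ne.symm e1))
    subst this
    exact absurd (le_antisymm hp hq) (Ne.symm e1)

variable {K : ℝ} {ν : Fin n → Measure ℝ} [∀ j, IsProbabilityMeasure (ν j)]

theorem integrable_chaos (hν : ∀ j, IsStdBounded K (ν j)) (p : Fin n × Fin n) :
    Integrable (chaos p) (Measure.pi ν) :=
  Integrable.fintype_prod fun m => (hν m).integrable (continuous_chaosFactor p m)

theorem integrable_chaos_mul (hν : ∀ j, IsStdBounded K (ν j)) (p q : Fin n × Fin n) :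
    Integrable (fun x => chaos p x * chaos q x) (Measure.pi ν) := by
  simp_rw [chaos, ← Finset.prod_mul_distrib]
  exact Integrable.fintype_prod (f := fun m x => chaosFactor p m x * chaosFactor q m x) fun m =>
    (hν m).integrable ((continuous_chaosFactor p m).mul (continuous_chaosFactor q m))

theorem integral_chaos_mul_eq_zero (hν : ∀ j, IsStdBounded K (ν j)) {p q : Fin n × Fin n}
    (hp : p.1 ≤ p.2) (hq : q.1 ≤ q.2) (hpq : p ≠ q) :
    ∫ x, chaos p x * chaos q x ∂Measure.pi ν = 0 := by
  simp_rw [chaos, ← Finset.prod_mul_distrib]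
  rw [integral_fintype_prod_eq_prod (fun m x => chaosFactor p m x * chaosFactor q m x)]
  obtain ⟨m, hm⟩ := exists_chaosFactor_integral_eq_zero hν hp hq hpq
  exact Finset.prod_eq_zero (Finset.mem_univ m) hm

theorem integral_chaos_eq_zero (hν : ∀ j, IsStdBounded K (ν j)) (p : Fin n × Fin n) :
    ∫ x, chaos p x ∂Measure.pi ν = 0 := by
  simp_rw [chaos]
  rw [integral_fintype_prod_eq_prod (chaosFactor p)]
  refine Finset.prod_eq_zero (Finset.mem_univ p.1) ?_
  by_cases h : p.2 = p.1
  · simpa [chaosFactor, h] using (hν p.1).integral_sq_sub_one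
  · simpa [chaosFactor, h] using (hν p.1).mean

theorem integral_chaos_sq_le (hν : ∀ j, IsStdBounded K (ν j)) (p : Fin n × Fin n) :
    ∫ x, chaos p x * chaos p x ∂Measure.pi ν ≤ K ^ 2 := by
  have hK := (hν p.1).one_le_sq
  simp_rw [chaos, ← Finset.prod_mul_distrib]
  rw [integral_fintype_prod_eq_prod (fun m x => chaosFactor p m x * chaosFactor p m x)]
  by_cases h : p.1 = p.2
  · rw [Finset.prod_eq_single p.1]
    · simpa [chaosFactor, ← h, ← sq] using (hν p.1).integral_sq_sub_one_sq_le
    · intro m _ hm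
      simp [chaosFactor, ← h, hm.symm]
    · simp
  · refine le_trans (le_of_eq ?_) hK
    refine Finset.prod_eq_one fun m _ => ?_
    by_cases h1 : p.1 = m
    · have h2 : p.2 ≠ m := fun h2 => h (h1.trans h2.symm)
      simpa [chaosFactor, h1, h2, ← sq] using (hν m).second
    · by_cases h2 : p.2 = m
      · simpa [chaosFactor, h1, h2, ← sq] using (hν m).second
      · simp [chaosFactor, h1, h2]

theorem sum_pair_eq_sum_le (f : Fin n × Fin n → ℝ) :
    ∑ p, f p = ∑ p : Fin n × Fin n with p.1 ≤ p.2, if p.1 = p.2 then f p else f p + f p.swap := by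
  have h1 : ∑ p : Fin n × Fin n with ¬ (p.1 ≤ p.2), f p = ∑ p : Fin n × Fin n with p.1 < p.2, f p.swap := by
    refine Finset.sum_nbij' Prod.swap Prod.swap ?_ ?_ ?_ ?_ ?_ <;> simp
  have h2 : ∑ p : Fin n × Fin n with p.1 < p.2, f p.swap =
      ∑ p : Fin n × Fin n with p.1 ≤ p.2, if p.1 = p.2 then 0 else f p.swap := by
    rw [Finset.sum_filter, Finset.sum_filter]
    refine Finset.sum_congr rfl fun p _ => ?_
    rcases lt_trichotomy p.1 p.2 with h | h | h
    · simp [h, h.le, h.ne]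
    · simp [h]
    · simp [h.not_ge, h.le]
  rw [← Finset.sum_filter_add_sum_filter_not Finset.univ (fun p : Fin n × Fin n => p.1 ≤ p.2), h1,
    h2, ← Finset.sum_add_distrib]
  refine Finset.sum_congr rfl fun p _ => ?_
  split_ifs <;> simp

/-- The centred quadratic form with matrix `A`. -/
def centeredForm (A : Fin n → Fin n → ℝ) (x : Fin n → ℝ) : ℝ :=
  ∑ i, ∑ j, A i j * (x i * x j) - ∑ i, A i i

/-- Coefficients of a quadratic form in terms of the polynomials `chaos p`. -/
def chaosCoeff (A : Fin n → Fin n → ℝ) (p : Fin n × Fin n) : ℝ :=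
  if p.1 = p.2 then A p.1 p.2 else A p.1 p.2 + A p.2 p.1

theorem centeredForm_eq (A : Fin n → Fin n → ℝ) (x : Fin n → ℝ) :
    centeredForm A x = ∑ p : Fin n × Fin n with p.1 ≤ p.2, chaosCoeff A p * chaos p x := by
  have h1 : ∑ i, A i i = ∑ p : Fin n × Fin n with p.1 ≤ p.2, if p.1 = p.2 then A p.1 p.2 else 0 := by
    rw [Finset.sum_filter, Fintype.sum_prod_type]
    refine Finset.sum_congr rfl fun i _ => ?_
    rw [Finset.sum_eq_single i] <;> simp
    intro j hj _ h
    exact absurd h.symm hj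
  rw [centeredForm, h1, ← Fintype.sum_prod_type' (fun i j => A i j * (x i * x j)),
    sum_pair_eq_sum_le, ← Finset.sum_sub_distrib]
  refine Finset.sum_congr rfl fun p _ => ?_
  by_cases h : p.1 = p.2
  · simp only [h, chaosCoeff, if_true, chaos_of_eq h]
    ring
  · simp only [h, chaosCoeff, if_false, chaos_of_ne h, Prod.swap]
    ring

theorem integrable_centeredForm (hν : ∀ j, IsStdBounded K (ν j)) (A : Fin n → Fin n → ℝ) :
    Integrable (centeredForm A) (Measure.pi ν) := by
  have : centeredForm A = fun x => ∑ p : Fin n × Fin n with p.1 ≤ p.2, chaosCoeff A p * chaos p x :=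
    funext (centeredForm_eq A)
  rw [this]
  exact integrable_finsetSum _ fun p _ => (integrable_chaos hν p).const_mul _

theorem integral_centeredForm (hν : ∀ j, IsStdBounded K (ν j)) (A : Fin n → Fin n → ℝ) :
    ∫ x, centeredForm A x ∂Measure.pi ν = 0 := by
  simp_rw [centeredForm_eq]
  rw [integral_finsetSum _ fun p _ => (integrable_chaos hν p).const_mul _]
  refine Finset.sum_eq_zero fun p _ => ?_
  rw [integral_const_mul, integral_chaos_eq_zero hν, mul_zero]

theorem centeredForm_sq (A : Fin n → Fin n → ℝ) (x : Fin n → ℝ) :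
    centeredForm A x ^ 2 = ∑ p : Fin n × Fin n with p.1 ≤ p.2, ∑ q : Fin n × Fin n with q.1 ≤ q.2,
      chaosCoeff A p * chaosCoeff A q * (chaos p x * chaos q x) := by
  rw [sq, centeredForm_eq, Finset.sum_mul_sum]
  exact Finset.sum_congr rfl fun p _ => Finset.sum_congr rfl fun q _ => by ring

theorem integrable_centeredForm_sq (hν : ∀ j, IsStdBounded K (ν j)) (A : Fin n → Fin n → ℝ) :
    Integrable (fun x => centeredForm A x ^ 2) (Measure.pi ν) := by
  simp_rw [centeredForm_sq]
  exact integrable_finsetSum _ fun p _ => integrable_finsetSum _ fun q _ =>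
    (integrable_chaos_mul hν p q).const_mul _

theorem integral_centeredForm_sq_le (hν : ∀ j, IsStdBounded K (ν j)) (A : Fin n → Fin n → ℝ) :
    ∫ x, centeredForm A x ^ 2 ∂Measure.pi ν ≤ 2 * K ^ 2 * ∑ i, ∑ j, A i j ^ 2 := by
  simp_rw [centeredForm_sq]
  rw [integral_finsetSum _ fun p _ => integrable_finsetSum _ fun q _ =>
    (integrable_chaos_mul hν p q).const_mul _]
  calc _ = ∑ p : Fin n × Fin n with p.1 ≤ p.2,
        chaosCoeff A p * chaosCoeff A p * ∫ x, chaos p x * chaos p x ∂Measure.pi ν := by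
        refine Finset.sum_congr rfl fun p hp => ?_
        rw [integral_finsetSum _ fun q _ => (integrable_chaos_mul hν p q).const_mul _]
        rw [Finset.sum_eq_single_of_mem p hp, integral_const_mul]
        intro q hq hqp
        rw [integral_const_mul, integral_chaos_mul_eq_zero hν (Finset.mem_filter.1 hp).2
          (Finset.mem_filter.1 hq).2 hqp.symm, mul_zero]
    _ ≤ ∑ p : Fin n × Fin n with p.1 ≤ p.2, (if p.1 = p.2 then A p.1 p.2 ^ 2 else
          A p.1 p.2 ^ 2 + A p.2 p.1 ^ 2) * (2 * K ^ 2) := by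
        refine Finset.sum_le_sum fun p _ => ?_
        have h0 := integral_chaos_sq_le hν p
        have h1 : chaosCoeff A p * chaosCoeff A p ≤
            2 * (if p.1 = p.2 then A p.1 p.2 ^ 2 else A p.1 p.2 ^ 2 + A p.2 p.1 ^ 2) := by
          unfold chaosCoeff
          split_ifs
          · nlinarith [sq_nonneg (A p.1 p.2)]
          · nlinarith [sq_nonneg (A p.1 p.2 - A p.2 p.1)]
        calc _ ≤ chaosCoeff A p * chaosCoeff A p * K ^ 2 :=
              mul_le_mul_of_nonneg_left h0 (mul_self_nonneg _)
          _ ≤ _ := by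
              have := mul_le_mul_of_nonneg_right h1 (sq_nonneg K)
              linarith
    _ = _ := by
        rw [← Finset.sum_mul, ← Fintype.sum_prod_type' (fun i j => A i j ^ 2), sum_pair_eq_sum_le]
        simp only [Prod.swap]
        ring

end Chaos

/-- Cantelli's one-sided inequality. -/
theorem measureReal_ge_le_cantelli {Ω : Type*} [MeasurableSpace Ω] {μ : Measure Ω}
    [IsProbabilityMeasure μ] {T : Ω → ℝ} (hT : Integrable T μ) (hT2 : Integrable (fun ω => T ω ^ 2) μ)
    (h0 : ∫ ω, T ω ∂μ = 0) {s a : ℝ} (hs : ∫ ω, T ω ^ 2 ∂μ ≤ s) (ha : 0 < a) :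
    μ.real {ω | a ≤ T ω} ≤ s / (s + a ^ 2) := by
  have hs0 : 0 ≤ s := (integral_nonneg fun ω => sq_nonneg (T ω)).trans hs
  set b := s / a with hb
  have hb0 : 0 ≤ b := div_nonneg hs0 ha.le
  have hexp : ∀ ω, (T ω + b) ^ 2 = T ω ^ 2 + (2 * b) * T ω + b ^ 2 := fun ω => by ring
  have hi2 : Integrable (fun ω => T ω ^ 2 + (2 * b) * T ω) μ := hT2.add (hT.const_mul _)
  have hi : Integrable (fun ω => (T ω + b) ^ 2) μ := by
    simp_rw [hexp]
    exact hi2.add (integrable_const _)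
  have h1 : ∫ ω, (T ω + b) ^ 2 ∂μ ≤ s + b ^ 2 := by
    simp_rw [hexp]
    rw [integral_add hi2 (integrable_const _), integral_add hT2 (hT.const_mul _),
      integral_const_mul, h0]
    simpa using hs
  have h2 := mul_meas_ge_le_integral_of_nonneg (μ := μ)
    (ae_of_all _ fun ω => sq_nonneg (T ω + b)) hi ((a + b) ^ 2)
  have h3 : μ.real {ω | a ≤ T ω} ≤ μ.real {ω | (a + b) ^ 2 ≤ (T ω + b) ^ 2} := by
    refine measureReal_mono fun ω hω => ?_
    have : a ≤ T ω := hω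
    have hab : a + b ≤ T ω + b := by linarith
    exact pow_le_pow_left₀ (add_pos_of_pos_of_nonneg ha hb0).le hab 2
  have h4 : (a + b) ^ 2 * μ.real {ω | a ≤ T ω} ≤ s + b ^ 2 :=
    ((mul_le_mul_of_nonneg_left h3 (sq_nonneg _)).trans h2).trans h1
  rw [le_div_iff₀ (by positivity)]
  have hba : b * a = s := by rw [hb]; field_simp
  have h5 : (a + b) ^ 2 * a ^ 2 = (s + a ^ 2) ^ 2 := by rw [← hba]; ring
  have h6 : (s + b ^ 2) * a ^ 2 = s * (s + a ^ 2) := by rw [← hba]; ring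
  have h7 := mul_le_mul_of_nonneg_right h4 (sq_nonneg a)
  have h8 : (s + a ^ 2) * (μ.real {ω | a ≤ T ω} * (s + a ^ 2)) ≤ (s + a ^ 2) * s := by
    calc _ = (a + b) ^ 2 * a ^ 2 * μ.real {ω | a ≤ T ω} := by rw [h5]; ring
      _ = (a + b) ^ 2 * μ.real {ω | a ≤ T ω} * a ^ 2 := by ring
      _ ≤ (s + b ^ 2) * a ^ 2 := h7
      _ = _ := by rw [h6]; ring
  exact le_of_mul_le_mul_left h8 (by positivity)

section SmallBall

variable {n : ℕ} {K : ℝ} {ν : Fin n → Measure ℝ} [∀ j, IsProbabilityMeasure (ν j)]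

/-- A linear form is bounded away from zero with probability bounded below. -/
theorem measureReal_linearForm_sq_le (hν : ∀ j, IsStdBounded K (ν j)) (u : Fin n → ℝ)
    (hu : 0 < ∑ j, u j ^ 2) :
    (Measure.pi ν).real {x | (∑ j, u j * x j) ^ 2 ≤ (∑ j, u j ^ 2) / 2} ≤
      1 - 1 / (8 * K ^ 2 + 1) := by
  set s := ∑ j, u j ^ 2 with hs
  have hform : ∀ x, centeredForm (fun i j => u i * u j) x = (∑ j, u j * x j) ^ 2 - s := by
    intro x
    rw [centeredForm, sq, Finset.sum_mul_sum, hs]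
    congr 1
    · exact Finset.sum_congr rfl fun i _ => Finset.sum_congr rfl fun j _ => by ring
    · exact Finset.sum_congr rfl fun i _ => by ring
  have hA : ∑ i, ∑ j, (u i * u j) ^ 2 = s ^ 2 := by
    rw [sq s, hs, Finset.sum_mul_sum]
    exact Finset.sum_congr rfl fun i _ => Finset.sum_congr rfl fun j _ => by ring
  have h2 := integral_centeredForm_sq_le hν (fun i j => u i * u j)
  rw [hA] at h2
  have := measureReal_ge_le_cantelli (μ := Measure.pi ν)
    (T := fun x => -centeredForm (fun i j => u i * u j) x)
    (integrable_centeredForm hν _).neg (by simpa using integrable_centeredForm_sq hν _)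
    (by rw [integral_neg, integral_centeredForm hν, neg_zero])
    (s := 2 * K ^ 2 * s ^ 2) (a := s / 2) (by simpa using h2) (by positivity)
  have hset : {x | s / 2 ≤ -centeredForm (fun i j => u i * u j) x} =
      {x : Fin n → ℝ | (∑ j, u j * x j) ^ 2 ≤ s / 2} := by
    ext x
    simp only [Set.mem_ofPred_eq, hform]
    constructor <;> intro h <;> linarith
  rw [hset] at this
  refine this.trans (le_of_eq ?_)
  field_simp
  ring

open scoped ENNReal in
/-- The expected negative part of the normalised deviation of `xᵀ P x` from its mean `tr P`, for
`P` with squared Frobenius norm `tr P`. -/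
theorem lintegral_one_sub_form_le (hν : ∀ j, IsStdBounded K (ν j)) (P : Fin n → Fin n → ℝ) {D : ℝ}
    (hD : 0 < D) (htr : ∑ i, P i i = D) (hfr : ∑ i, ∑ j, P i j ^ 2 = D) :
    ∫⁻ x, ENNReal.ofReal (1 - (∑ i, ∑ j, P i j * (x i * x j)) / D) ∂Measure.pi ν ≤
      ENNReal.ofReal ((K ^ 2 + 1) / √D) := by
  have hsq : √D * √D = D := Real.mul_self_sqrt hD.le
  have hsp : 0 < √D := Real.sqrt_pos.2 hD
  have hint : Integrable (fun x => (centeredForm P x ^ 2 / √D + √D) / (2 * D)) (Measure.pi ν) :=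
    (((integrable_centeredForm_sq hν P).div_const _).add (integrable_const _)).div_const _
  calc _ ≤ ∫⁻ x, ENNReal.ofReal ((centeredForm P x ^ 2 / √D + √D) / (2 * D)) ∂Measure.pi ν := by
        refine lintegral_mono fun x => ENNReal.ofReal_le_ofReal ?_
        have : ∑ i, ∑ j, P i j * (x i * x j) = centeredForm P x + D := by
          rw [centeredForm, htr]; ring
        rw [this]
        have e : 1 - (centeredForm P x + D) / D = -centeredForm P x / D := by field_simp; ring
        rw [e, div_le_div_iff₀ hD (by positivity)]
        have : 0 ≤ (centeredForm P x + √D) ^ 2 / √D := by positivity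
        have e2 : (centeredForm P x + √D) ^ 2 / √D =
            centeredForm P x ^ 2 / √D + √D + 2 * centeredForm P x := by
          field_simp
          ring
        rw [e2] at this
        nlinarith
    _ = ENNReal.ofReal (∫ x, (centeredForm P x ^ 2 / √D + √D) / (2 * D) ∂Measure.pi ν) :=
        (ofReal_integral_eq_lintegral_ofReal hint (ae_of_all _ fun x => by positivity)).symm
    _ ≤ _ := by
        refine ENNReal.ofReal_le_ofReal ?_
        rw [integral_div, integral_add ((integrable_centeredForm_sq hν P).div_const _)
          (integrable_const _), integral_div]
        have h2 := integral_centeredForm_sq_le hν P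
        rw [hfr] at h2
        simp only [integral_const, probReal_univ, smul_eq_mul, one_mul]
        rw [div_le_div_iff₀ (by positivity) hsp, add_mul, div_mul_cancel₀ _ hsp.ne', hsq]
        nlinarith [sq_nonneg K]

end SmallBall

theorem exists_mem_apply_eq_one_norm_le_one {n : ℕ} {V : Submodule ℝ (Fin n → ℝ)} (hV : V ≠ ⊥) :
    ∃ v ∈ V, ∃ j, v j = 1 ∧ ‖v‖ ≤ 1 := by
  obtain ⟨v, hv, hv0⟩ := V.ne_bot_iff.1 hV
  obtain ⟨i, hi⟩ := Function.ne_iff.1 hv0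
  obtain ⟨j, -, hj⟩ := Finset.exists_max_image Finset.univ (fun k => |v k|) ⟨i, Finset.mem_univ i⟩
  have hj0 : 0 < |v j| := (abs_pos.2 hi).trans_le (hj i (Finset.mem_univ i))
  refine ⟨(v j)⁻¹ • v, V.smul_mem _ hv, j, ?_, ?_⟩
  · simp [inv_mul_cancel₀ (abs_pos.1 hj0)]
  · rw [pi_norm_le_iff_of_nonneg zero_le_one]
    intro k
    simp only [Pi.smul_apply, smul_eq_mul, norm_mul, norm_inv, Real.norm_eq_abs]
    rw [inv_mul_le_iff₀ hj0, mul_one]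
    exact hj k (Finset.mem_univ k)

theorem exists_submodule_apply_eq_zero {n d : ℕ} {V : Submodule ℝ (Fin n → ℝ)}
    (hV : d + 1 ≤ Module.finrank ℝ V) (j : Fin n) :
    ∃ V' ≤ V, (∀ v ∈ V', v j = 0) ∧ d ≤ Module.finrank ℝ V' := by
  let f : V →ₗ[ℝ] ℝ := (LinearMap.proj j).domRestrict V
  refine ⟨(LinearMap.ker f).map V.subtype, Submodule.map_subtype_le _ _, ?_, ?_⟩
  · rintro _ ⟨v, hv, rfl⟩
    exact hv
  · rw [Submodule.finrank_map_subtype_eq]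
    have h1 := LinearMap.finrank_range_add_finrank_ker f
    have h2 : Module.finrank ℝ (LinearMap.range f) ≤ 1 := by
      simpa using Submodule.finrank_le (LinearMap.range f)
    omega

theorem isClosed_setOf_forms_le {n : ℕ} (V : Submodule ℝ (Fin n → ℝ)) (r : ℝ) :
    IsClosed {x : Fin n → ℝ | ∀ v ∈ V, |∑ j, v j * x j| ≤ r * ‖v‖} := by
  simp only [Set.ofPred_forall]
  exact isClosed_iInter fun v => isClosed_iInter fun _ => isClosed_le (by fun_prop) (by fun_prop)

/-- A random vector is close to a fixed subspace of codimension `d` with probability exponentially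
small in `d`. -/
theorem measure_forms_le_pow {n : ℕ} {K : ℝ} {ν : Fin n → Measure ℝ}
    [∀ j, IsProbabilityMeasure (ν j)] (hν : ∀ j, IsStdBounded K (ν j)) (d : ℕ)
    (V : Submodule ℝ (Fin n → ℝ)) (hd : d ≤ Module.finrank ℝ V) :
    Measure.pi ν {x | ∀ v ∈ V, |∑ j, v j * x j| ≤ 1 / 2 * ‖v‖} ≤
      ENNReal.ofReal (1 - 3 / (8 * K ^ 2)) ^ d := by
  induction d generalizing V with
  | zero => simpa using prob_le_one
  | succ d ih =>
    have hV : V ≠ ⊥ := by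
      rintro rfl
      simp at hd
    obtain ⟨v, hv, j, hvj, hvn⟩ := exists_mem_apply_eq_one_norm_le_one hV
    obtain ⟨V', hV', hV'j, hV'd⟩ := exists_submodule_apply_eq_zero hd j
    set E := {x : Fin n → ℝ | ∀ v ∈ V', |∑ j, v j * x j| ≤ 1 / 2 * ‖v‖} with hE
    set G := {x : Fin n → ℝ | |∑ j, v j * x j| ≤ 1 / 2} with hG
    have hsub : {x : Fin n → ℝ | ∀ v ∈ V, |∑ j, v j * x j| ≤ 1 / 2 * ‖v‖} ⊆ E ∩ G := by
      refine fun x hx => ⟨fun w hw => hx w (hV' hw), ?_⟩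
      have := hx v hv
      show |∑ j, v j * x j| ≤ 1 / 2
      linarith
    refine (measure_mono hsub).trans ?_
    rw [pow_succ']
    refine (measure_pi_inter_le_mul ν (isClosed_setOf_forms_le V' _).measurableSet
      (isClosed_le (by fun_prop) (by fun_prop)).measurableSet j ?_
      (p := ENNReal.ofReal (1 - 3 / (8 * K ^ 2))) ?_).trans (mul_le_mul_right (ih V' hV'd) _)
    · intro x y
      have : ∀ w ∈ V', ∑ k, w k * Function.update x j y k = ∑ k, w k * x k := by
        intro w hw
        refine Finset.sum_congr rfl fun k _ => ?_
        rcases eq_or_ne k j with rfl | hk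
        · simp [hV'j w hw]
        · simp [hk]
      exact forall₂_congr fun w hw => by rw [this w hw]
    · intro x _
      have h1 : {y | Function.update x j y ∈ G} =
          {y | |y - (-∑ k ∈ Finset.univ.erase j, v k * x k)| ≤ 1 / 2} := by
        ext y
        have : ∑ k, v k * Function.update x j y k =
            y - (-∑ k ∈ Finset.univ.erase j, v k * x k) := by
          rw [← Finset.add_sum_erase _ _ (Finset.mem_univ j), Function.update_self, hvj, one_mul,
            sub_neg_eq_add]
          congr 1
          refine Finset.sum_congr rfl fun k hk => ?_
          rw [Function.update_of_ne (Finset.ne_of_mem_erase hk)]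
        simp only [hG, Set.mem_ofPred_eq, this]
      rw [h1, ← ofReal_measureReal]
      exact ENNReal.ofReal_le_ofReal ((hν j).measureReal_abs_sub_le _)

section Combinatorics

variable {α : Type*} [Fintype α] [DecidableEq α]

theorem sum_mem_eq_sum_ite (A : Finset α) (f : α → ℝ) :
    ∑ i ∈ A, f i = ∑ i, if i ∈ A then f i else 0 := by
  rw [Finset.sum_ite_mem, Finset.univ_inter]

/-- The Littlewood-Offord bound via Sperner's theorem. -/
theorem card_subset_sums_le_choose (a : α → ℝ) (c r : ℝ) (ha : ∀ i, 2 * r < |a i|)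
    (F : Finset (Finset α)) (hF : ∀ A ∈ F, |c + ∑ i ∈ A, a i| ≤ r) :
    F.card ≤ (Fintype.card α).choose (Fintype.card α / 2) := by
  set N : Finset α := Finset.univ.filter fun i => a i < 0 with hN
  have hinj : Function.Injective fun A : Finset α => symmDiff A N := symmDiff_left_injective N
  have hsum : ∀ A : Finset α, ∑ i ∈ A, a i = ∑ i ∈ symmDiff A N, |a i| - ∑ i ∈ N, |a i| := by
    intro A
    rw [sum_mem_eq_sum_ite A, sum_mem_eq_sum_ite (symmDiff A N), sum_mem_eq_sum_ite N,
      ← Finset.sum_sub_distrib]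
    refine Finset.sum_congr rfl fun i _ => ?_
    by_cases h1 : i ∈ A <;> by_cases h2 : a i < 0
    · simp [hN, h1, h2, Finset.mem_symmDiff, abs_of_neg h2]
    · simp [hN, h1, h2, Finset.mem_symmDiff, abs_of_nonneg (not_lt.1 h2)]
    · simp [hN, h1, h2, Finset.mem_symmDiff]
    · simp [hN, h1, h2, Finset.mem_symmDiff]
  rw [← Finset.card_image_of_injective F hinj]
  refine IsAntichain.sperner ?_
  rintro _ hB _ hB' hne hsub
  obtain ⟨A, hA, rfl⟩ := Finset.mem_image.1 (Finset.mem_coe.1 hB)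
  obtain ⟨A', hA', rfl⟩ := Finset.mem_image.1 (Finset.mem_coe.1 hB')
  have h1 := hF A hA
  have h2 := hF A' hA'
  rw [hsum] at h1 h2
  have hss : symmDiff A N ⊂ symmDiff A' N := (Finset.ssubset_iff_subset_ne).2 ⟨hsub, hne⟩
  obtain ⟨i, hi, hi'⟩ := Finset.exists_of_ssubset hss
  have h3 : ∑ i ∈ symmDiff A N, |a i| + |a i| ≤ ∑ i ∈ symmDiff A' N, |a i| := by
    rw [add_comm, ← Finset.sum_insert (f := fun i => |a i|) hi']
    refine Finset.sum_le_sum_of_subset_of_nonneg ?_ fun _ _ _ => abs_nonneg _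
    exact Finset.insert_subset hi hsub
  have := ha i
  rw [abs_le] at h1 h2
  linarith

/-- The Littlewood-Offord bound when only the steps indexed by `T` are large. -/
theorem card_subset_sums_le (a : α → ℝ) (c r : ℝ) (T : Finset α) (ha : ∀ i ∈ T, 2 * r < |a i|)
    (F : Finset (Finset α)) (hF : ∀ A ∈ F, |c + ∑ i ∈ A, a i| ≤ r) :
    F.card ≤ T.card.choose (T.card / 2) * 2 ^ (Fintype.card α - T.card) := by
  have h1 : F.card ≤ T.card.choose (T.card / 2) * (Tᶜ).powerset.card := by
    refine Finset.card_le_mul_card_image_of_maps_to (f := fun A => A \ T) ?_ _ ?_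
    · intro A _
      rw [Finset.mem_powerset]
      intro i hi
      simpa using (Finset.mem_sdiff.1 hi).2
    · intro B _
      set F' := F.filter fun A => A \ T = B with hF'
      have hinj : Set.InjOn (fun A : Finset α => A.subtype (· ∈ T)) F' := by
        intro A hA A' hA' h
        have e1 := (Finset.mem_filter.1 (Finset.mem_coe.1 hA)).2
        have e2 := (Finset.mem_filter.1 (Finset.mem_coe.1 hA')).2
        ext i
        by_cases hi : i ∈ T
        · have : (⟨i, hi⟩ : {x // x ∈ T}) ∈ A.subtype (· ∈ T) ↔
              (⟨i, hi⟩ : {x // x ∈ T}) ∈ A'.subtype (· ∈ T) := by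
            simp only at h
            rw [h]
          simpa using this
        · have : i ∈ A \ T ↔ i ∈ A' \ T := by rw [e1, e2]
          simpa [hi] using this
      rw [← Finset.card_image_of_injOn hinj]
      have := card_subset_sums_le_choose (α := {x // x ∈ T}) (fun i => a i) (c + ∑ i ∈ B, a i) r
        (fun i => ha i i.2) (F'.image fun A : Finset α => A.subtype (· ∈ T)) ?_
      · simpa using this
      · intro C hC
        obtain ⟨A, hA, rfl⟩ := Finset.mem_image.1 hC
        obtain ⟨hA1, hA2⟩ := Finset.mem_filter.1 hA
        have e : ∑ i ∈ A.subtype (· ∈ T), a i = ∑ i ∈ A with i ∈ T, a i := by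
          rw [← Finset.subtype_map, Finset.sum_map]
          rfl
        have e2 : ∑ i ∈ B, a i + ∑ i ∈ A with i ∈ T, a i = ∑ i ∈ A, a i := by
          rw [← hA2, Finset.sdiff_eq_filter, add_comm, Finset.sum_filter_add_sum_filter_not]
        rw [e, add_assoc, e2]
        exact hF A hA1
  rwa [Finset.card_powerset, Finset.card_compl] at h1

end Combinatorics

theorem centralBinom_sq_mul_le (n : ℕ) : n.centralBinom ^ 2 * (2 * n + 1) ≤ 16 ^ n := by
  induction n with
  | zero => simp
  | succ n ih =>
    have h := Nat.succ_mul_centralBinom_succ n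
    have h2 : (n + 1) ^ 2 * ((n + 1).centralBinom ^ 2 * (2 * (n + 1) + 1)) ≤
        (n + 1) ^ 2 * 16 ^ (n + 1) := by
      calc _ = ((n + 1) * (n + 1).centralBinom) ^ 2 * (2 * n + 3) := by ring
        _ = (n.centralBinom ^ 2 * (2 * n + 1)) * (4 * ((2 * n + 1) * (2 * n + 3))) := by
            rw [h]; ring
        _ ≤ 16 ^ n * (4 * (4 * (n + 1) ^ 2)) :=
            Nat.mul_le_mul ih (by nlinarith)
        _ = _ := by ring
    exact Nat.le_of_mul_le_mul_left h2 (by positivity)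

theorem choose_middle_sq_mul_le (n : ℕ) : n.choose (n / 2) ^ 2 * (n + 1) ≤ 4 ^ n := by
  obtain ⟨m, rfl | rfl⟩ := n.even_or_odd'
  · have := centralBinom_sq_mul_le m
    rw [Nat.centralBinom_eq_two_mul_choose] at this
    rw [Nat.mul_div_cancel_left _ two_pos, pow_mul]
    exact this
  · have h := centralBinom_sq_mul_le (m + 1)
    have e : (m + 1).centralBinom = 2 * (2 * m + 1).choose m := by
      rw [Nat.centralBinom_eq_two_mul_choose, show 2 * (m + 1) = 2 * m + 1 + 1 by ring,
        Nat.choose_succ_succ', Nat.choose_symm_half]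
      ring
    rw [e] at h
    rw [show (2 * m + 1) / 2 = m by omega]
    have e2 : (4 : ℕ) * 4 ^ (2 * m + 1) = 16 ^ (m + 1) := by
      rw [← pow_succ', show (16 : ℕ) = 4 ^ 2 by norm_num, ← pow_mul]
      congr 1
    nlinarith [sq_nonneg ((2 * m + 1).choose m)]

theorem choose_middle_le (n : ℕ) : (n.choose (n / 2) : ℝ) ≤ 2 ^ n / √(n + 1) := by
  have hpos : (0 : ℝ) < n + 1 := by positivity
  rw [le_div_iff₀ (Real.sqrt_pos.2 hpos)]
  refine le_of_sq_le_sq ?_ (by positivity)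
  rw [mul_pow, Real.sq_sqrt hpos.le, ← pow_mul, mul_comm n 2, pow_mul]
  have := choose_middle_sq_mul_le n
  norm_num
  exact_mod_cast this

/-- A bound for the number of small subset sums which is insensitive to few large steps. -/
theorem card_subset_sums_le_real {α : Type*} [Fintype α] [DecidableEq α] (a : α → ℝ) (c r : ℝ)
    (T : Finset α) (ha : ∀ i ∈ T, 2 * r < |a i|) (F : Finset (Finset α))
    (hF : ∀ A ∈ F, |c + ∑ i ∈ A, a i| ≤ r) (k : ℕ) :
    (F.card : ℝ) ≤ 2 ^ Fintype.card α * (1 / √(k + 1) + 2 ^ k * (1 / 2) ^ T.card) := by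
  rcases lt_or_ge T.card k with h | h
  · have h1 : F.card ≤ 2 ^ Fintype.card α := by
      simpa using Finset.card_le_univ F
    have h2 : (1 : ℝ) ≤ 2 ^ k * (1 / 2) ^ T.card := by
      rw [one_div, inv_pow, ← div_eq_mul_inv, one_le_div (by positivity)]
      exact pow_le_pow_right₀ one_le_two h.le
    calc (F.card : ℝ) ≤ 2 ^ Fintype.card α * 1 := by rw [mul_one]; exact_mod_cast h1
      _ ≤ _ := by
        have : 0 ≤ 1 / √((k : ℝ) + 1) := by positivity
        gcongr
        linarith
  · have h1 := card_subset_sums_le a c r T ha F hF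
    have h2 : (F.card : ℝ) ≤ (T.card.choose (T.card / 2) : ℝ) * 2 ^ (Fintype.card α - T.card) := by
      exact_mod_cast h1
    have h3 := choose_middle_le T.card
    have h4 : (2 : ℝ) ^ T.card * 2 ^ (Fintype.card α - T.card) = 2 ^ Fintype.card α := by
      rw [← pow_add, Nat.add_sub_cancel' T.card_le_univ]
    calc (F.card : ℝ) ≤ 2 ^ T.card / √(T.card + 1) * 2 ^ (Fintype.card α - T.card) :=
          h2.trans (by gcongr)
      _ = 2 ^ Fintype.card α * (1 / √(T.card + 1)) := by rw [← h4]; ring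
      _ ≤ 2 ^ Fintype.card α * (1 / √(k + 1)) := by gcongr
      _ ≤ _ := by
        gcongr
        have : (0 : ℝ) ≤ 2 ^ k * (1 / 2) ^ T.card := by positivity
        linarith

section SmallBall

variable {n : ℕ} {K : ℝ} {ν : Fin n → Measure ℝ} [∀ j, IsProbabilityMeasure (ν j)]

theorem measurePreserving_swap_coords (A : Finset (Fin n)) :
    MeasurePreserving (fun (z : Fin n → ℝ × ℝ) j => if j ∈ A then (z j).2 else (z j).1)
      (Measure.pi fun j => (ν j).prod (ν j)) (Measure.pi ν) := by
  refine measurePreserving_pi (fun j => (ν j).prod (ν j)) ν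
    (f := fun j w => if j ∈ A then w.2 else w.1) fun j => ?_
  by_cases h : j ∈ A
  · simpa [h] using measurePreserving_snd (μ := ν j) (ν := ν j)
  · simpa [h] using measurePreserving_fst (μ := ν j) (ν := ν j)

/-- Discount factor: `1 / 2` for a coordinate in `S` where the two copies are far apart. -/
noncomputable def farFactor (S : Finset (Fin n)) (j : Fin n) (w : ℝ × ℝ) : ℝ :=
  if j ∈ S ∧ 1 / 2 < |w.2 - w.1| then 1 / 2 else 1

theorem measurable_farFactor (S : Finset (Fin n)) (j : Fin n) : Measurable (farFactor S j) := by
  refine Measurable.ite ?_ measurable_const measurable_const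
  by_cases h : j ∈ S
  · simpa [h] using measurableSet_lt (f := fun _ : ℝ × ℝ => (2 : ℝ)⁻¹)
      (g := fun w : ℝ × ℝ => |w.2 - w.1|) (by fun_prop) (by fun_prop)
  · simp [h]

theorem integrable_farFactor (S : Finset (Fin n)) (j : Fin n) :
    Integrable (farFactor S j) ((ν j).prod (ν j)) := by
  refine Integrable.of_bound (measurable_farFactor S j).aestronglyMeasurable 1 (ae_of_all _ ?_)
  intro w
  unfold farFactor
  split_ifs <;> norm_num

theorem integral_farFactor_le (hν : ∀ j, IsStdBounded K (ν j)) (S : Finset (Fin n)) (j : Fin n) :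
    ∫ w, farFactor S j w ∂(ν j).prod (ν j) ≤ if j ∈ S then 1 - 3 / (16 * K ^ 2) else 1 := by
  rw [integral_prod _ (integrable_farFactor S j)]
  by_cases h : j ∈ S
  · simp only [h, if_true]
    have key : ∀ x, ∫ y, farFactor S j (x, y) ∂ν j ≤ 1 - 3 / (16 * K ^ 2) := by
      intro x
      have hm : MeasurableSet {y : ℝ | |y - x| ≤ 1 / 2} :=
        measurableSet_le (by fun_prop) (by fun_prop)
      have e : ∀ y, farFactor S j (x, y) =
          1 / 2 + {y : ℝ | |y - x| ≤ 1 / 2}.indicator (fun _ => (1 / 2 : ℝ)) y := by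
        intro y
        by_cases hy : |y - x| ≤ 1 / 2
        · rw [Set.indicator_of_mem (by exact hy), farFactor, if_neg (by simpa [h] using hy)]
          norm_num
        · rw [Set.indicator_of_notMem (by exact hy), farFactor, if_pos ⟨h, not_le.1 hy⟩]
          norm_num
      simp_rw [e]
      rw [integral_add (integrable_const _) ((integrable_const _).indicator hm),
        integral_indicator_const _ hm]
      have := (hν j).measureReal_abs_sub_le x
      have e2 : 3 / (16 * K ^ 2) = 3 / (8 * K ^ 2) / 2 := by
        rw [div_div]; congr 1; ring
      simp only [integral_const, probReal_univ, smul_eq_mul, one_mul]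
      rw [e2]
      linarith
    calc _ ≤ ∫ _, (1 - 3 / (16 * K ^ 2)) ∂ν j :=
          integral_mono (integrable_farFactor S j).integral_prod_left (integrable_const _) key
      _ = _ := by simp
  · simp [h, farFactor]

theorem prod_farFactor (S : Finset (Fin n)) (z : Fin n → ℝ × ℝ) :
    ∏ j, farFactor S j (z j) =
      (1 / 2) ^ (Finset.univ.filter fun j => j ∈ S ∧ 1 / 2 < |(z j).2 - (z j).1|).card := by
  simp only [farFactor]
  rw [Finset.prod_ite]
  simp

/-- A Littlewood-Offord type bound for linear forms with many large coefficients. -/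
theorem measureReal_linearForm_le (hν : ∀ j, IsStdBounded K (ν j)) (v : Fin n → ℝ)
    (S : Finset (Fin n)) {τ : ℝ} (hτ : 0 < τ) (hS : ∀ j ∈ S, τ ≤ |v j|) (k : ℕ) :
    (Measure.pi ν).real {x | |∑ j, v j * x j| ≤ τ / 4} ≤
      1 / √(k + 1) + 2 ^ k * (1 - 3 / (16 * K ^ 2)) ^ S.card := by
  classical
  set G := {x : Fin n → ℝ | |∑ j, v j * x j| ≤ τ / 4} with hG
  have hGm : MeasurableSet G := measurableSet_le (by fun_prop) (by fun_prop)
  set ρ := fun j => (ν j).prod (ν j) with hρ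
  set σ := fun (A : Finset (Fin n)) (z : Fin n → ℝ × ℝ) (j : Fin n) =>
    if j ∈ A then (z j).2 else (z j).1 with hσ
  have hσp : ∀ A, MeasurePreserving (σ A) (Measure.pi ρ) (Measure.pi ν) :=
    fun A => measurePreserving_swap_coords A
  have hσm : ∀ A, MeasurableSet (σ A ⁻¹' G) := fun A => (hσp A).measurable hGm
  have h1 : ∀ A, (Measure.pi ν).real G = ∫ z, (σ A ⁻¹' G).indicator (fun _ => (1 : ℝ)) z
      ∂Measure.pi ρ := by
    intro A
    rw [integral_indicator_const _ (hσm A), smul_eq_mul, mul_one, measureReal_def,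
      measureReal_def, (hσp A).measure_preimage hGm.nullMeasurableSet]
  have h2 : 2 ^ n * (Measure.pi ν).real G =
      ∫ z, ∑ A, (σ A ⁻¹' G).indicator (fun _ => (1 : ℝ)) z ∂Measure.pi ρ := by
    rw [integral_finsetSum _ fun A _ => (integrable_const _).indicator (hσm A),
      ← Finset.sum_congr rfl fun A _ => h1 A]
    simp
  have hprod : Integrable (fun z : Fin n → ℝ × ℝ => ∏ j, farFactor S j (z j)) (Measure.pi ρ) :=
    Integrable.fintype_prod fun j => integrable_farFactor S j
  have h3 : ∀ z, ∑ A, (σ A ⁻¹' G).indicator (fun _ => (1 : ℝ)) z ≤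
      2 ^ n * (1 / √(k + 1) + 2 ^ k * ∏ j, farFactor S j (z j)) := by
    intro z
    rw [prod_farFactor]
    have e1 : ∑ A, (σ A ⁻¹' G).indicator (fun _ => (1 : ℝ)) z =
        ((Finset.univ.filter fun A => σ A z ∈ G).card : ℝ) := by
      rw [Finset.card_filter]
      push_cast
      refine Finset.sum_congr rfl fun A _ => ?_
      simp [Set.indicator_apply]
    rw [e1]
    have := card_subset_sums_le_real (fun j => v j * ((z j).2 - (z j).1)) (∑ j, v j * (z j).1)
      (τ / 4) (Finset.univ.filter fun j => j ∈ S ∧ 1 / 2 < |(z j).2 - (z j).1|) ?_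
      (Finset.univ.filter fun A => σ A z ∈ G) ?_ k
    · simpa using this
    · intro j hj
      obtain ⟨-, hjS, hjz⟩ := Finset.mem_filter.1 hj
      have := hS j hjS
      rw [abs_mul]
      nlinarith
    · intro A hA
      have : |∑ j, v j * σ A z j| ≤ τ / 4 := (Finset.mem_filter.1 hA).2
      convert this using 2
      rw [sum_mem_eq_sum_ite A, ← Finset.sum_add_distrib]
      refine Finset.sum_congr rfl fun j _ => ?_
      simp only [hσ]
      split_ifs <;> ring
  have h4 : ∏ j, ∫ w, farFactor S j w ∂ρ j ≤ (1 - 3 / (16 * K ^ 2)) ^ S.card := by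
    calc _ ≤ ∏ j, (if j ∈ S then 1 - 3 / (16 * K ^ 2) else 1) := by
          refine Finset.prod_le_prod (fun j _ => integral_nonneg fun w => ?_)
            fun j _ => integral_farFactor_le hν S j
          unfold farFactor
          split_ifs <;> norm_num
      _ = _ := by simp
  have h5 : 2 ^ n * (Measure.pi ν).real G ≤
      2 ^ n * (1 / √(k + 1) + 2 ^ k * (1 - 3 / (16 * K ^ 2)) ^ S.card) := by
    rw [h2]
    calc _ ≤ ∫ z, 2 ^ n * (1 / √(k + 1) + 2 ^ k * ∏ j, farFactor S j (z j)) ∂Measure.pi ρ :=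
          integral_mono (integrable_finsetSum _ fun A _ => (integrable_const _).indicator (hσm A))
            (((integrable_const _).add (hprod.const_mul _)).const_mul _) h3
      _ = 2 ^ n * (1 / √(k + 1) + 2 ^ k * ∏ j, ∫ w, farFactor S j w ∂ρ j) := by
          rw [integral_const_mul, integral_add (integrable_const _) (hprod.const_mul _),
            integral_const_mul, integral_fintype_prod_eq_prod (farFactor S)]
          simp
      _ ≤ _ := by gcongr
  exact le_of_mul_le_mul_left h5 (by positivity)

end SmallBall

/-- The vector supported on the range of `f` with entries in `N⁻¹ ℤ ∩ [-1, 1]` given by `g`. -/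
noncomputable def gridVector {n m N : ℕ} (p : (Fin m → Fin n) × (Fin m → Fin (2 * N + 1)))
    (j : Fin n) : ℝ :=
  ∑ k, if p.1 k = j then (((p.2 k : ℕ) : ℝ) - N) / N else 0

/-- The matrices whose first `q` rows all have a small product with some sparse grid vector. -/
def sparseBad (n m N q : ℕ) : Set (Fin n → Fin n → ℝ) :=
  ⋃ p : (Fin m → Fin n) × (Fin m → Fin (2 * N + 1)),
    {M | 0 < ∑ j, gridVector p j ^ 2 ∧ ∀ i : Fin n, (i : ℕ) < q →
      (∑ j, gridVector p j * M i j) ^ 2 ≤ (∑ j, gridVector p j ^ 2) / 2}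

theorem measurableSet_sparseBad (n m N q : ℕ) : MeasurableSet (sparseBad n m N q) := by
  refine MeasurableSet.iUnion fun p => ?_
  refine (MeasurableSet.const (0 < ∑ j, gridVector p j ^ 2)).inter (s₂ := {M : Fin n → Fin n → ℝ | ∀ i : Fin n,
    (i : ℕ) < q → (∑ j, gridVector p j * M i j) ^ 2 ≤ (∑ j, gridVector p j ^ 2) / 2}) ?_
  simp only [Set.ofPred_forall]
  exact MeasurableSet.iInter fun i => MeasurableSet.iInter fun _ =>
    measurableSet_le (by fun_prop) (by fun_prop)

theorem update_mem_sparseBad {n m N q : ℕ} {i : Fin n} (hi : q ≤ i) (M : Fin n → Fin n → ℝ)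
    (y : Fin n → ℝ) : Function.update M i y ∈ sparseBad n m N q ↔ M ∈ sparseBad n m N q := by
  have h : ∀ k : Fin n, (k : ℕ) < q → Function.update M i y k = M k := by
    intro k hk
    refine Function.update_of_ne ?_ _ _
    rintro rfl
    omega
  simp only [sparseBad, Set.mem_iUnion, Set.mem_ofPred_eq]
  refine exists_congr fun p => and_congr Iff.rfl (forall₂_congr fun k hk => ?_)
  rw [h k hk]

theorem measure_sparseBad_le {n m N q : ℕ} (hq : q ≤ n) {K : ℝ} {ν : Fin n → Fin n → Measure ℝ}
    [∀ i j, IsProbabilityMeasure (ν i j)] (hν : ∀ i j, IsStdBounded K (ν i j)) :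
    Measure.pi (fun i => Measure.pi (ν i)) (sparseBad n m N q) ≤
      (n : ENNReal) ^ m * (2 * N + 1 : ENNReal) ^ m *
        ENNReal.ofReal (1 - 1 / (8 * K ^ 2 + 1)) ^ q := by
  have hp : ∀ p : (Fin m → Fin n) × (Fin m → Fin (2 * N + 1)),
      Measure.pi (fun i => Measure.pi (ν i)) {M | 0 < ∑ j, gridVector p j ^ 2 ∧
        ∀ i : Fin n, (i : ℕ) < q →
          (∑ j, gridVector p j * M i j) ^ 2 ≤ (∑ j, gridVector p j ^ 2) / 2} ≤
        ENNReal.ofReal (1 - 1 / (8 * K ^ 2 + 1)) ^ q := by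
    intro p
    by_cases h0 : 0 < ∑ j, gridVector p j ^ 2
    · set S : Fin n → Set (Fin n → ℝ) := fun i => if (i : ℕ) < q then
        {x | (∑ j, gridVector p j * x j) ^ 2 ≤ (∑ j, gridVector p j ^ 2) / 2} else Set.univ with hS
      calc _ ≤ Measure.pi (fun i => Measure.pi (ν i)) (Set.univ.pi S) := by
            refine measure_mono fun M hM i _ => ?_
            by_cases hi : (i : ℕ) < q
            · simpa [hS, hi] using hM.2 i hi
            · simp [hS, hi]
        _ = ∏ i, Measure.pi (ν i) (S i) := Measure.pi_pi _ _
        _ ≤ ∏ i : Fin n, (if (i : ℕ) < q then ENNReal.ofReal (1 - 1 / (8 * K ^ 2 + 1)) else 1) := by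
            refine Finset.prod_le_prod' fun i _ => ?_
            by_cases hi : (i : ℕ) < q
            · simp only [hS, hi, if_true]
              rw [← ofReal_measureReal]
              exact ENNReal.ofReal_le_ofReal (measureReal_linearForm_sq_le (hν i) _ h0)
            · simp only [hS, hi, if_false]
              exact prob_le_one
        _ = _ := by
            rw [Finset.prod_ite, Finset.prod_const_one, mul_one, Finset.prod_const,
              Fin.card_filter_val_lt, min_eq_right hq]
    · simp [h0]
  calc _ ≤ ∑ p : (Fin m → Fin n) × (Fin m → Fin (2 * N + 1)), _ := measure_iUnion_fintype_le _ _
    _ ≤ ∑ p : (Fin m → Fin n) × (Fin m → Fin (2 * N + 1)),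
        ENNReal.ofReal (1 - 1 / (8 * K ^ 2 + 1)) ^ q := Finset.sum_le_sum fun p _ => hp p
    _ = _ := by
        rw [Finset.sum_const, nsmul_eq_mul, Finset.card_univ, Fintype.card_prod, Fintype.card_fun,
          Fintype.card_fun]
        simp

theorem exists_grid_approx {N : ℕ} (hN : 0 < N) {x : ℝ} (hx : |x| ≤ 1) :
    ∃ a : Fin (2 * N + 1), |(((a : ℕ) : ℝ) - N) / N - x| ≤ 1 / N ∧
      (x = 1 → (((a : ℕ) : ℝ) - N) / N = 1) := by
  have hN' : (0 : ℝ) < N := by exact_mod_cast hN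
  rw [abs_le] at hx
  have h0 : 0 ≤ N * (x + 1) := by nlinarith
  refine ⟨⟨⌊N * (x + 1)⌋₊, ?_⟩, ?_, ?_⟩
  · have : ⌊N * (x + 1)⌋₊ ≤ 2 * N := by
      refine Nat.floor_le_of_le ?_
      push_cast
      nlinarith
    omega
  · have h1 := Nat.floor_le h0
    have h2 := Nat.lt_floor_add_one (N * (x + 1))
    have e : (((⌊N * (x + 1)⌋₊ : ℕ) : ℝ) - N) / N - x =
        ((⌊N * (x + 1)⌋₊ : ℝ) - N * (x + 1)) / N := by field_simp; ring
    simp only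
    rw [e, abs_div, abs_of_pos hN']
    gcongr
    rw [abs_le]
    constructor <;> linarith
  · rintro rfl
    have : ⌊(N : ℝ) * (1 + 1)⌋₊ = 2 * N := by
      rw [show (N : ℝ) * (1 + 1) = ((2 * N : ℕ) : ℝ) by push_cast; ring, Nat.floor_natCast]
    simp only [this]
    push_cast
    field_simp
    ring

/-- Vectors supported on few coordinates can be approximated by grid vectors. -/
theorem exists_gridVector {n m N : ℕ} (hN : 0 < N) (S : Finset (Fin n)) (hS : S.card ≤ m)
    (v : Fin n → ℝ) (hv : ∀ j, |v j| ≤ 1) {j₀ : Fin n} (hj₀ : j₀ ∈ S) (hv₀ : v j₀ = 1) :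
    ∃ p : (Fin m → Fin n) × (Fin m → Fin (2 * N + 1)),
      (∀ j ∈ S, |gridVector p j - v j| ≤ 1 / N) ∧ (∀ j ∉ S, gridVector p j = 0) ∧
      gridVector p j₀ = 1 := by
  choose a ha ha1 using fun j => exists_grid_approx hN (hv j)
  obtain ⟨e⟩ : Nonempty ({x // x ∈ S} ↪ Fin m) :=
    Function.Embedding.nonempty_of_card_le (by simpa using hS)
  set f : Fin m → Fin n := Function.extend e Subtype.val fun _ => j₀ with hf
  set g : Fin m → Fin (2 * N + 1) := Function.extend e (fun s => a s) fun _ => ⟨N, by omega⟩ with hg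
  have key : ∀ j, gridVector (f, g) j = if j ∈ S then (((a j : ℕ) : ℝ) - N) / N else 0 := by
    intro j
    have h1 : ∑ s : {x // x ∈ S}, (if (s : Fin n) = j then (((a s : ℕ) : ℝ) - N) / N else 0) =
        gridVector (f, g) j := by
      refine Fintype.sum_of_injective e e.injective _ _ ?_ ?_
      · intro k hk
        have : ¬ ∃ s, e s = k := hk
        simp [hg, Function.extend_apply' _ _ _ this]
      · intro s
        simp [hf, hg, e.injective.extend_apply]
    rw [← h1, Finset.sum_coe_sort S (fun s => if s = j then (((a s : ℕ) : ℝ) - N) / N else 0),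
      Finset.sum_ite_eq']
  refine ⟨(f, g), ?_, ?_, ?_⟩
  · intro j hj
    rw [key, if_pos hj]
    exact ha j
  · intro j hj
    rw [key, if_neg hj]
  · rw [key, if_pos hj₀]
    exact ha1 j₀ hv₀

/-- Outside `sparseBad`, vectors orthogonal to the first `q` rows have many large coordinates. -/
theorem lt_card_large_of_notMem_sparseBad {n m N q : ℕ} {K : ℝ} (hK : 1 ≤ K)
    (hN : 4 * K * m ≤ N) (hN0 : 0 < N) {M : Fin n → Fin n → ℝ} (hM : M ∉ sparseBad n m N q)
    (hb : ∀ i : Fin n, (i : ℕ) < q → ∀ j, |M i j| ≤ K) {v : Fin n → ℝ} (hv : ∀ j, |v j| ≤ 1)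
    {j₀ : Fin n} (hv₀ : v j₀ = 1) (hMv : ∀ i : Fin n, (i : ℕ) < q → ∑ j, v j * M i j = 0) :
    m < (Finset.univ.filter fun j => 1 / (4 * K * n) ≤ |v j|).card := by
  by_contra! hS
  have hn : (1 : ℝ) ≤ n := by exact_mod_cast j₀.pos
  have hj₀ : j₀ ∈ Finset.univ.filter fun j => 1 / (4 * K * n) ≤ |v j| := by
    rw [Finset.mem_filter]
    refine ⟨Finset.mem_univ _, ?_⟩
    rw [hv₀, abs_one, div_le_one (by positivity)]
    nlinarith
  obtain ⟨p, hp1, hp2, hp3⟩ := exists_gridVector hN0 _ hS v hv hj₀ hv₀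
  set S := Finset.univ.filter fun j => 1 / (4 * K * n) ≤ |v j| with hSdef
  have hs1 : 1 ≤ ∑ j, gridVector p j ^ 2 := by
    calc (1 : ℝ) = gridVector p j₀ ^ 2 := by rw [hp3]; norm_num
      _ ≤ _ := Finset.single_le_sum (f := fun j => gridVector p j ^ 2)
          (fun j _ => sq_nonneg _) (Finset.mem_univ j₀)
  refine hM (Set.mem_iUnion.2 ⟨p, by linarith, fun i hi => ?_⟩)
  have hN' : (0 : ℝ) < N := by exact_mod_cast hN0
  have h1 : ∑ j, gridVector p j * M i j = ∑ j, (gridVector p j - v j) * M i j := by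
    simp_rw [sub_mul]
    rw [Finset.sum_sub_distrib, hMv i hi, sub_zero]
  have h2 : ∑ j, |gridVector p j - v j| ≤ 1 / (2 * K) := by
    rw [← Finset.sum_filter_add_sum_filter_not Finset.univ (fun j => 1 / (4 * K * n) ≤ |v j|),
      ← hSdef]
    have e1 : ∑ j ∈ S, |gridVector p j - v j| ≤ 1 / (4 * K) := by
      calc _ ≤ ∑ j ∈ S, 1 / (N : ℝ) := Finset.sum_le_sum hp1
        _ = S.card / N := by rw [Finset.sum_const, nsmul_eq_mul, mul_one_div]
        _ ≤ m / N := by gcongr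
        _ ≤ 1 / (4 * K) := by
          rw [div_le_div_iff₀ hN' (by positivity)]
          linarith
    have e2 : ∑ j with ¬ 1 / (4 * K * n) ≤ |v j|, |gridVector p j - v j| ≤ 1 / (4 * K) := by
      calc _ ≤ ∑ j : Fin n with ¬ 1 / (4 * K * n) ≤ |v j|, 1 / (4 * K * n) := by
            refine Finset.sum_le_sum fun j hj => ?_
            have hj' := (Finset.mem_filter.1 hj).2
            rw [hp2 j (by simpa [hSdef] using hj'), zero_sub, abs_neg]
            exact (not_le.1 hj').le
        _ ≤ ∑ j : Fin n, 1 / (4 * K * n) :=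
            Finset.sum_le_sum_of_subset_of_nonneg (Finset.filter_subset _ _)
              fun _ _ _ => by positivity
        _ = 1 / (4 * K) := by
            rw [Finset.sum_const, Finset.card_univ, Fintype.card_fin, nsmul_eq_mul]
            field_simp
    have e3 : 1 / (2 * K) = 1 / (4 * K) + 1 / (4 * K) := by field_simp; norm_num
    linarith
  have h3 : |∑ j, gridVector p j * M i j| ≤ 1 / 2 := by
    rw [h1]
    calc _ ≤ ∑ j, |(gridVector p j - v j) * M i j| := Finset.abs_sum_le_sum_abs _ _
      _ ≤ ∑ j, |gridVector p j - v j| * K := by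
          refine Finset.sum_le_sum fun j _ => ?_
          rw [abs_mul]
          exact mul_le_mul_of_nonneg_left (hb i hi j) (abs_nonneg _)
      _ ≤ 1 / (2 * K) * K := by
          rw [← Finset.sum_mul]
          gcongr
      _ = 1 / 2 := by field_simp
  have h4 := pow_le_pow_left₀ (abs_nonneg _) h3 2
  rw [sq_abs] at h4
  linarith

section GramSchmidt

variable {n : ℕ}

/-- The Gram-Schmidt process applied to the rows of a matrix. -/
noncomputable def rowGramSchmidt (M : Fin n → Fin n → ℝ) (i : Fin n) : EuclideanSpace ℝ (Fin n) :=
  InnerProductSpace.gramSchmidt ℝ (fun k => WithLp.toLp 2 (M k)) i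

theorem measurable_rowGramSchmidt (i : Fin n) :
    Measurable fun M : Fin n → Fin n → ℝ => rowGramSchmidt M i := by
  induction i using WellFoundedLT.induction with
  | _ i ih =>
    have hrow : Measurable fun M : Fin n → Fin n → ℝ =>
        (WithLp.toLp 2 (M i) : EuclideanSpace ℝ (Fin n)) :=
      (WithLp.measurable_toLp 2 _).comp (measurable_pi_apply i)
    have e : (fun M : Fin n → Fin n → ℝ => rowGramSchmidt M i) = fun M =>
        WithLp.toLp 2 (M i) - ∑ k ∈ Finset.Iio i,
          (inner ℝ (rowGramSchmidt M k) (WithLp.toLp 2 (M i)) / ‖rowGramSchmidt M k‖ ^ 2) •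
            rowGramSchmidt M k := by
      funext M
      rw [eq_sub_iff_add_eq]
      exact (InnerProductSpace.gramSchmidt_def'' ℝ (fun k => WithLp.toLp 2 (M k)) i).symm
    rw [e]
    refine hrow.sub (Finset.measurable_sum _ fun k hk => ?_)
    have hk' := ih k (Finset.mem_Iio.1 hk)
    exact ((hk'.inner hrow).div (hk'.norm.pow_const 2)).smul hk'

/-- The vectors orthogonal to the rows of `M` preceding row `i`. -/
def normalSpace (M : Fin n → Fin n → ℝ) (i : Fin n) : Submodule ℝ (Fin n → ℝ) :=
  LinearMap.ker (Matrix.mulVecLin (Matrix.of fun (k : Fin i) j => M (Fin.castLE i.2.le k) j))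

theorem mem_normalSpace {M : Fin n → Fin n → ℝ} {i : Fin n} {v : Fin n → ℝ} :
    v ∈ normalSpace M i ↔ ∀ k < i, ∑ j, v j * M k j = 0 := by
  rw [normalSpace, LinearMap.mem_ker, funext_iff]
  constructor
  · intro h k hk
    have := h ⟨k, hk⟩
    simpa [Matrix.mulVec, dotProduct, mul_comm] using this
  · intro h k
    have := h (Fin.castLE i.2.le k) (by rw [Fin.lt_def]; exact k.2)
    simpa [Matrix.mulVec, dotProduct, mul_comm] using this

theorem le_finrank_normalSpace (M : Fin n → Fin n → ℝ) (i : Fin n) :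
    n - i ≤ Module.finrank ℝ (normalSpace M i) := by
  have h1 := LinearMap.finrank_range_add_finrank_ker
    (Matrix.mulVecLin (Matrix.of fun (k : Fin i) j => M (Fin.castLE i.2.le k) j))
  have h2 := Submodule.finrank_le (LinearMap.range
    (Matrix.mulVecLin (Matrix.of fun (k : Fin i) j => M (Fin.castLE i.2.le k) j)))
  simp only [Module.finrank_fin_fun] at h1 h2
  unfold normalSpace
  omega

theorem normalSpace_update (M : Fin n → Fin n → ℝ) (i : Fin n) (y : Fin n → ℝ) :
    normalSpace (Function.update M i y) i = normalSpace M i := by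
  ext v
  simp only [mem_normalSpace]
  refine forall₂_congr fun k hk => ?_
  rw [Function.update_of_ne hk.ne]

theorem inner_toLp_eq_sum (v : EuclideanSpace ℝ (Fin n)) (x : Fin n → ℝ) :
    inner ℝ v (WithLp.toLp 2 x) = ∑ j, v j * x j := by
  simp [PiLp.inner_apply, mul_comm]

theorem inner_rowGramSchmidt {M : Fin n → Fin n → ℝ} {i : Fin n} {v : EuclideanSpace ℝ (Fin n)}
    (hv : v.ofLp ∈ normalSpace M i) :
    inner ℝ v (rowGramSchmidt M i) = ∑ j, v j * M i j := by
  set f : Fin n → EuclideanSpace ℝ (Fin n) := fun k => WithLp.toLp 2 (M k) with hf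
  have h0 : ∀ k < i, inner ℝ v (rowGramSchmidt M k) = 0 := by
    intro k hk
    have hmem : rowGramSchmidt M k ∈ Submodule.span ℝ (f '' Set.Iic k) :=
      InnerProductSpace.gramSchmidt_mem_span ℝ f le_rfl
    have hle : Submodule.span ℝ (f '' Set.Iic k) ≤ (ℝ ∙ v)ᗮ := by
      rw [Submodule.span_le]
      rintro _ ⟨l, hl, rfl⟩
      rw [SetLike.mem_coe, Submodule.mem_orthogonal_singleton_iff_inner_right, hf,
        inner_toLp_eq_sum]
      exact mem_normalSpace.1 hv l (lt_of_le_of_lt hl hk)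
    exact (Submodule.mem_orthogonal_singleton_iff_inner_right).1 (hle hmem)
  have h1 := InnerProductSpace.gramSchmidt_def'' ℝ f i
  rw [← inner_toLp_eq_sum, show WithLp.toLp 2 (M i) = f i from rfl, h1, inner_add_right, inner_sum,
    Finset.sum_eq_zero, add_zero]
  · rfl
  · intro k hk
    rw [inner_smul_right]
    exact mul_eq_zero_of_right _ (h0 k (Finset.mem_Iio.1 hk))

theorem abs_form_le_norm_rowGramSchmidt {M : Fin n → Fin n → ℝ} {i : Fin n} {v : Fin n → ℝ}
    (hv : v ∈ normalSpace M i) :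
    |∑ j, v j * M i j| ≤ √n * ‖v‖ * ‖rowGramSchmidt M i‖ := by
  have h := inner_rowGramSchmidt (v := WithLp.toLp 2 v) (M := M) (i := i) hv
  have h1 : ∑ j, (WithLp.toLp 2 v : EuclideanSpace ℝ (Fin n)) j * M i j = ∑ j, v j * M i j := rfl
  rw [← h1, ← h]
  refine (abs_real_inner_le_norm _ _).trans ?_
  gcongr
  rw [EuclideanSpace.norm_eq]
  have : ∑ j, ‖(WithLp.toLp 2 v : EuclideanSpace ℝ (Fin n)) j‖ ^ 2 ≤ n * ‖v‖ ^ 2 := by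
    calc _ ≤ ∑ _j : Fin n, ‖v‖ ^ 2 :=
          Finset.sum_le_sum fun j _ => pow_le_pow_left₀ (norm_nonneg _) (norm_le_pi_norm v j) 2
      _ = _ := by simp
  calc _ ≤ √(n * ‖v‖ ^ 2) := Real.sqrt_le_sqrt this
    _ = _ := by rw [Real.sqrt_mul (by positivity), Real.sqrt_sq (norm_nonneg v)]

theorem exists_orthonormal_normal (M : Fin n → Fin n → ℝ) (i : Fin n) :
    ∃ b : Fin (n - i) → EuclideanSpace ℝ (Fin n), Orthonormal ℝ b ∧
      ∀ a, (b a).ofLp ∈ normalSpace M i := by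
  set V := (normalSpace M i).map (WithLp.linearEquiv 2 ℝ (Fin n → ℝ)).symm.toLinearMap with hV
  have hle : n - i ≤ Module.finrank ℝ V := by
    rw [hV, LinearEquiv.finrank_map_eq]
    exact le_finrank_normalSpace M i
  refine ⟨fun a => (stdOrthonormalBasis ℝ V (Fin.castLE hle a) : EuclideanSpace ℝ (Fin n)), ?_, ?_⟩
  · have h := (stdOrthonormalBasis ℝ V).orthonormal.comp (Fin.castLE hle)
      (Fin.castLE_injective hle)
    exact h.comp_linearIsometry V.subtypeₗᵢ
  · intro a
    obtain ⟨v, hv, h⟩ := (stdOrthonormalBasis ℝ V (Fin.castLE hle a)).2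
    exact (congrArg (· ∈ normalSpace M i) (congrArg WithLp.ofLp h.symm)).mpr hv

theorem sum_rotate {α β : Type*} [Fintype α] [Fintype β] (F : α → α → β → ℝ) :
    ∑ j, ∑ l, ∑ k, F j l k = ∑ k, ∑ j, ∑ l, F j l k :=
  (Finset.sum_congr rfl fun _ _ => Finset.sum_comm).trans Finset.sum_comm

/-- The squared norm of the component of row `i` orthogonal to the previous rows dominates a
quadratic form in that row whose matrix is a projection of rank `n - i`. -/
theorem exists_projection_form_le (M : Fin n → Fin n → ℝ) (i : Fin n) :
    ∃ P : Fin n → Fin n → ℝ, ∑ a, P a a = ((n - i : ℕ) : ℝ) ∧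
      ∑ a, ∑ b, P a b ^ 2 = ((n - i : ℕ) : ℝ) ∧
      ∀ y, ∑ a, ∑ b, P a b * (y a * y b) ≤ ‖rowGramSchmidt (Function.update M i y) i‖ ^ 2 := by
  obtain ⟨b, hb, hbV⟩ := exists_orthonormal_normal M i
  have hinner : ∀ k l, ∑ j, b k j * b l j = if k = l then 1 else 0 := by
    intro k l
    rw [← orthonormal_iff_ite.1 hb k l]
    simp [PiLp.inner_apply, mul_comm]
  refine ⟨fun j l => ∑ k, b k j * b k l, ?_, ?_, ?_⟩
  · rw [Finset.sum_comm]
    simp [hinner]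
  · have e : ∀ j l, (∑ k, b k j * b k l) ^ 2 =
        ∑ k, ∑ k', (b k j * b k' j) * (b k l * b k' l) := by
      intro j l
      rw [sq, Finset.sum_mul_sum]
      exact Finset.sum_congr rfl fun k _ => Finset.sum_congr rfl fun k' _ => by ring
    calc _ = ∑ k, ∑ k', ∑ j, ∑ l, (b k j * b k' j) * (b k l * b k' l) := by
          simp_rw [e]
          rw [sum_rotate]
          exact Finset.sum_congr rfl fun k _ => sum_rotate _
      _ = ∑ k, ∑ k', (∑ j, b k j * b k' j) * (∑ l, b k l * b k' l) := by
          simp_rw [Finset.sum_mul_sum]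
      _ = _ := by simp [hinner]
  · intro y
    have h1 : ∀ k, inner ℝ (b k) (rowGramSchmidt (Function.update M i y) i) = ∑ j, b k j * y j := by
      intro k
      rw [inner_rowGramSchmidt (by rw [normalSpace_update]; exact hbV k), Function.update_self]
    have h2 := hb.sum_inner_products_le (rowGramSchmidt (Function.update M i y) i)
      (s := Finset.univ)
    refine le_trans (le_of_eq ?_) h2
    simp_rw [h1, Real.norm_eq_abs, sq_abs, sq, Finset.sum_mul_sum, Finset.sum_mul]
    rw [sum_rotate]
    exact Finset.sum_congr rfl fun k _ => Finset.sum_congr rfl fun j _ =>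
      Finset.sum_congr rfl fun l _ => by ring

/-- The determinant is the product of the lengths of the Gram-Schmidt vectors. -/
theorem abs_det_eq_prod_norm_rowGramSchmidt {M : Fin n → Fin n → ℝ}
    (hM : ∀ i, 0 < ‖rowGramSchmidt M i‖) :
    |(Matrix.of M).det| = ∏ i, ‖rowGramSchmidt M i‖ := by
  set f : Fin n → EuclideanSpace ℝ (Fin n) := fun k => WithLp.toLp 2 (M k) with hf
  have hfr : Module.finrank ℝ (EuclideanSpace ℝ (Fin n)) = Fintype.card (Fin n) := by simp
  have h1 := InnerProductSpace.gramSchmidtOrthonormalBasis_det hfr f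
  have hne : ∀ i, InnerProductSpace.gramSchmidt ℝ f i ≠ 0 := fun i => norm_pos_iff.1 (hM i)
  have h2 : ∀ i, inner ℝ (InnerProductSpace.gramSchmidtOrthonormalBasis hfr f i) (f i) =
      ‖rowGramSchmidt M i‖ := by
    intro i
    have hn : InnerProductSpace.gramSchmidtNormed ℝ f i ≠ 0 := by
      rw [InnerProductSpace.gramSchmidtNormed]
      simpa using hne i
    have h3 : inner ℝ (InnerProductSpace.gramSchmidt ℝ f i) (f i) =
        ‖InnerProductSpace.gramSchmidt ℝ f i‖ ^ 2 := by
      rw [InnerProductSpace.gramSchmidt_def'' ℝ f i, inner_add_right, inner_sum,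
        Finset.sum_eq_zero, add_zero, real_inner_self_eq_norm_sq]
      intro k hk
      rw [inner_smul_right,
        InnerProductSpace.gramSchmidt_orthogonal ℝ f (Finset.mem_Iio.1 hk).ne', mul_zero]
    rw [InnerProductSpace.gramSchmidtOrthonormalBasis_apply hfr hn,
      InnerProductSpace.gramSchmidtNormed, real_inner_smul_left, h3, sq]
    exact inv_mul_cancel_left₀ (norm_ne_zero_iff.2 (hne i)) _
  simp_rw [h2] at h1
  rw [← h1]
  set e := EuclideanSpace.basisFun (Fin n) ℝ with he
  have h3 : e.toBasis.det f = (Matrix.of M).det := by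
    rw [Module.Basis.det_apply, ← Matrix.det_transpose]
    congr 1
  set b := InnerProductSpace.gramSchmidtOrthonormalBasis hfr f with hb
  have h4 : e.toBasis.det f = e.toBasis.det b * b.toBasis.det f := by
    conv_lhs => rw [e.toBasis.det.eq_smul_basis_det b.toBasis]
    simp
  have h5 : ‖e.toBasis.det b‖ = 1 := e.det_to_matrix_orthonormalBasis b
  rw [← h3, h4, abs_mul, ← Real.norm_eq_abs (e.toBasis.det b), h5, one_mul, abs_of_nonneg]
  rw [h1]
  exact Finset.prod_nonneg fun i _ => norm_nonneg _

end GramSchmidt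

section RowBounds

variable {n : ℕ} {K : ℝ} {ν : Fin n → Fin n → Measure ℝ} [∀ i j, IsProbabilityMeasure (ν i j)]

theorem lintegral_one_sub_norm_sq_le (hν : ∀ i j, IsStdBounded K (ν i j)) (i : Fin n) :
    ∫⁻ M, ENNReal.ofReal (1 - ‖rowGramSchmidt M i‖ ^ 2 / ((n - i : ℕ) : ℝ))
      ∂Measure.pi (fun i => Measure.pi (ν i)) ≤
      ENNReal.ofReal ((K ^ 2 + 1) / √((n - i : ℕ) : ℝ)) := by
  have hD : (0 : ℝ) < ((n - i : ℕ) : ℝ) := by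
    have := i.2
    exact_mod_cast (by omega : 0 < n - (i : ℕ))
  refine lintegral_pi_le_of_update (fun i => Measure.pi (ν i)) ?_ i fun M => ?_
  · exact ((((measurable_rowGramSchmidt i).norm.pow_const 2).div_const _).const_sub 1).ennreal_ofReal
  · obtain ⟨P, htr, hfr, hP⟩ := exists_projection_form_le M i
    refine le_trans (lintegral_mono fun y => ENNReal.ofReal_le_ofReal ?_)
      (lintegral_one_sub_form_le (hν i) P hD htr hfr)
    have := hP y
    gcongr

theorem measurableSet_norm_rowGramSchmidt_lt (i : Fin n) (η : ℝ) :
    MeasurableSet {M : Fin n → Fin n → ℝ | ‖rowGramSchmidt M i‖ < η} :=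
  measurableSet_lt (measurable_rowGramSchmidt i).norm measurable_const

theorem measure_norm_rowGramSchmidt_lt_le_pow (hν : ∀ i j, IsStdBounded K (ν i j)) (i : Fin n) :
    Measure.pi (fun i => Measure.pi (ν i)) {M | ‖rowGramSchmidt M i‖ < 1 / (2 * √n)} ≤
      ENNReal.ofReal (1 - 3 / (8 * K ^ 2)) ^ (n - i : ℕ) := by
  have hn : 0 < √(n : ℝ) := Real.sqrt_pos.2 (by exact_mod_cast i.pos)
  have := measure_pi_inter_le_mul (fun i => Measure.pi (ν i)) MeasurableSet.univ
    (measurableSet_norm_rowGramSchmidt_lt i (1 / (2 * √n))) i (by simp)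
    (p := ENNReal.ofReal (1 - 3 / (8 * K ^ 2)) ^ (n - i : ℕ)) ?_
  · simpa using this
  · intro M _
    refine (measure_mono ?_).trans
      (measure_forms_le_pow (hν i) (n - i) (normalSpace M i) (le_finrank_normalSpace M i))
    intro y hy v hv
    rw [← normalSpace_update M i y] at hv
    have h1 := abs_form_le_norm_rowGramSchmidt hv
    rw [Function.update_self] at h1
    have h2 : ‖rowGramSchmidt (Function.update M i y) i‖ < 1 / (2 * √n) := hy
    calc _ ≤ _ := h1
      _ ≤ √n * ‖v‖ * (1 / (2 * √n)) := by gcongr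
      _ = 1 / 2 * ‖v‖ := by field_simp

/-- The matrices whose first `q` rows are bounded by `K` and do not admit a sparse grid vector. -/
def regularRows (n m N q : ℕ) (K : ℝ) : Set (Fin n → Fin n → ℝ) :=
  (sparseBad n m N q)ᶜ ∩ {M | ∀ i : Fin n, (i : ℕ) < q → ∀ j, |M i j| ≤ K}

theorem measurableSet_regularRows (m N q : ℕ) : MeasurableSet (regularRows n m N q K) := by
  refine (measurableSet_sparseBad n m N q).compl.inter ?_
  simp only [Set.ofPred_forall]
  exact MeasurableSet.iInter fun i => MeasurableSet.iInter fun _ => MeasurableSet.iInter fun j =>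
    measurableSet_le (by fun_prop) (by fun_prop)

theorem measure_norm_rowGramSchmidt_lt_regularRows (hν : ∀ i j, IsStdBounded K (ν i j))
    {m N q : ℕ} (hN : 4 * K * m ≤ N) (hN0 : 0 < N) {i : Fin n} (hi : q ≤ i) (k : ℕ) :
    Measure.pi (fun i => Measure.pi (ν i))
      (regularRows n m N q K ∩ {M | ‖rowGramSchmidt M i‖ < 1 / (16 * K * n * √n)}) ≤
      ENNReal.ofReal (1 / √(k + 1) + 2 ^ k * (1 - 3 / (16 * K ^ 2)) ^ m) := by
  have hK := (hν i i).one_le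
  have hn0 : (0 : ℝ) < n := by exact_mod_cast i.pos
  have hn : 0 < √(n : ℝ) := Real.sqrt_pos.2 hn0
  have := measure_pi_inter_le_mul (fun i => Measure.pi (ν i)) (measurableSet_regularRows (K := K) m N q)
    (measurableSet_norm_rowGramSchmidt_lt i (1 / (16 * K * n * √n))) i ?_
    (p := ENNReal.ofReal (1 / √(k + 1) + 2 ^ k * (1 - 3 / (16 * K ^ 2)) ^ m)) ?_
  · exact this.trans (mul_le_of_le_one_right' prob_le_one)
  · intro M y
    refine and_congr (not_congr (update_mem_sparseBad hi M y)) (forall₂_congr fun l hl => ?_)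
    rw [Function.update_of_ne]
    rintro rfl
    omega
  · rintro M ⟨hM, hMb⟩
    have hV : normalSpace M i ≠ ⊥ := by
      intro h
      have := le_finrank_normalSpace M i
      rw [h, finrank_bot] at this
      have := i.2
      omega
    obtain ⟨v, hv, j₀, hvj, hvn⟩ := exists_mem_apply_eq_one_norm_le_one hV
    have hcard := lt_card_large_of_notMem_sparseBad hK hN hN0 hM hMb
      (fun j => (norm_le_pi_norm v j).trans hvn) hvj
      (fun l hl => mem_normalSpace.1 hv l (by rw [Fin.lt_def]; omega))
    set S := Finset.univ.filter fun j => 1 / (4 * K * n) ≤ |v j| with hS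
    have hLO := measureReal_linearForm_le (hν i) v S (τ := 1 / (4 * K * n)) (by positivity)
      (fun j hj => (Finset.mem_filter.1 hj).2) k
    rw [← ofReal_measureReal]
    refine ENNReal.ofReal_le_ofReal (le_trans ?_ (hLO.trans ?_))
    · refine measureReal_mono fun y hy => ?_
      have h2 : ‖rowGramSchmidt (Function.update M i y) i‖ < 1 / (16 * K * n * √n) := hy
      rw [← normalSpace_update M i y] at hv
      have h1 := abs_form_le_norm_rowGramSchmidt hv
      rw [Function.update_self] at h1
      show |∑ j, v j * y j| ≤ 1 / (4 * K * n) / 4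
      calc _ ≤ _ := h1
        _ ≤ √n * 1 * (1 / (16 * K * n * √n)) := by gcongr
        _ = _ := by field_simp; norm_num
    · have h3 : 3 / (16 * K ^ 2) ≤ 1 := by
        rw [div_le_one (by positivity)]
        nlinarith
      have h4 : 0 ≤ 3 / (16 * K ^ 2) := by positivity
      gcongr 1 / √(k + 1) + 2 ^ k * ?_
      exact pow_le_pow_of_le_one (by linarith) (by linarith) hcard.le

theorem sum_pow_sub_le {p : ℝ} (hp0 : 0 ≤ p) (hp1 : p < 1) (L : ℕ) :
    ∑ i : Fin n, (if (i : ℕ) < n - L then p ^ (n - i : ℕ) else 0) ≤ p ^ L / (1 - p) := by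
  have h1 : ∀ i : Fin n, (if (i : ℕ) < n - L then p ^ (n - i : ℕ) else 0) ≤
      p ^ L * p ^ (n - 1 - i - L : ℕ) * (if (i : ℕ) < n - L then 1 else 0) := by
    intro i
    split_ifs with h
    · rw [mul_one, ← pow_add]
      exact pow_le_pow_of_le_one hp0 hp1.le (by omega)
    · simp
  calc _ ≤ ∑ i : Fin n, p ^ L * p ^ (n - 1 - i - L : ℕ) * (if (i : ℕ) < n - L then 1 else 0) :=
        Finset.sum_le_sum fun i _ => h1 i
    _ = ∑ i ∈ Finset.range n,
        p ^ L * p ^ (n - 1 - i - L : ℕ) * (if i < n - L then 1 else 0) :=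
        Fin.sum_univ_eq_sum_range
          (fun i => p ^ L * p ^ (n - 1 - i - L : ℕ) * (if i < n - L then 1 else 0)) n
    _ = ∑ i ∈ Finset.range (n - L), p ^ L * p ^ (n - L - 1 - i : ℕ) := by
        simp only [mul_ite, mul_one, mul_zero]
        rw [← Finset.sum_filter]
        have : (Finset.range n).filter (fun i => i < n - L) = Finset.range (n - L) := by
          ext i
          simp only [Finset.mem_filter, Finset.mem_range]
          omega
        rw [this]
        refine Finset.sum_congr rfl fun i _ => ?_
        congr 2
        omega
    _ = p ^ L * ∑ i ∈ Finset.range (n - L), p ^ i := by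
        rw [← Finset.mul_sum, Finset.sum_range_reflect (fun i => p ^ i)]
    _ ≤ p ^ L * (1 - p)⁻¹ := by
        gcongr
        rw [← tsum_geometric_of_lt_one hp0 hp1]
        exact (summable_geometric_of_lt_one hp0 hp1).sum_le_tsum _ fun i _ => pow_nonneg hp0 i
    _ = _ := by rw [div_eq_mul_inv]

/-- All Gram-Schmidt vectors are polynomially bounded below with high probability. -/
theorem measure_exists_norm_rowGramSchmidt_lt_le (hν : ∀ i j, IsStdBounded K (ν i j))
    {m N L : ℕ} (hK : 1 ≤ K) (hN : 4 * K * m ≤ N) (hN0 : 0 < N) (k : ℕ) :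
    Measure.pi (fun i => Measure.pi (ν i))
      {M | ∃ i, ‖rowGramSchmidt M i‖ < 1 / (16 * K * n * √n)} ≤
      ENNReal.ofReal ((n : ℝ) ^ m * (2 * N + 1) ^ m * (1 - 1 / (8 * K ^ 2 + 1)) ^ (n - L) +
        (1 - 3 / (8 * K ^ 2)) ^ L / (1 - (1 - 3 / (8 * K ^ 2))) +
        L * (1 / √(k + 1) + 2 ^ k * (1 - 3 / (16 * K ^ 2)) ^ m)) := by
  set μ := Measure.pi (fun i => Measure.pi (ν i)) with hμ
  set η := 1 / (16 * K * n * √n) with hη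
  set p := 1 - 3 / (8 * K ^ 2) with hp
  set β := 1 / √(k + 1) + 2 ^ k * (1 - 3 / (16 * K ^ 2)) ^ m with hβ
  have hp0 : 0 ≤ p := by
    rw [hp, sub_nonneg, div_le_one (by positivity)]
    nlinarith
  have hp1 : p < 1 := by
    rw [hp]
    have : 0 < 3 / (8 * K ^ 2) := by positivity
    linarith
  have hβ0 : 0 ≤ β := by
    have h3 : 0 ≤ 1 - 3 / (16 * K ^ 2) := by
      rw [sub_nonneg, div_le_one (by positivity)]
      nlinarith
    positivity
  have hr0 : 0 ≤ 1 - 1 / (8 * K ^ 2 + 1) := by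
    rw [sub_nonneg, div_le_one (by positivity)]
    nlinarith
  have hbdd : μ {M | ∀ i : Fin n, (i : ℕ) < n - L → ∀ j, |M i j| ≤ K}ᶜ = 0 := by
    rw [← mem_ae_iff]
    have : ∀ i j, ∀ᵐ M ∂μ, |M i j| ≤ K := by
      intro i j
      have h1 : ∀ᵐ x ∂Measure.pi (ν i), |x j| ≤ K :=
        (measurePreserving_eval (ν i) j).quasiMeasurePreserving.ae (hν i j).bound
      exact (measurePreserving_eval (fun i => Measure.pi (ν i)) i).quasiMeasurePreserving.ae h1
    filter_upwards [ae_all_iff.2 fun i => ae_all_iff.2 (this i)] with M hM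
    exact fun i _ j => hM i j
  have hrow : ∀ i : Fin n, μ (if (i : ℕ) < n - L then {M | ‖rowGramSchmidt M i‖ < η} else
      regularRows n m N (n - L) K ∩ {M | ‖rowGramSchmidt M i‖ < η}) ≤
      ENNReal.ofReal ((if (i : ℕ) < n - L then p ^ (n - i : ℕ) else 0) +
        if (i : ℕ) < n - L then 0 else β) := by
    intro i
    have hn0 : (1 : ℝ) ≤ n := by exact_mod_cast i.pos
    have hn : 0 < √(n : ℝ) := Real.sqrt_pos.2 (by linarith)
    split_ifs with h
    · rw [add_zero, ENNReal.ofReal_pow hp0]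
      refine (measure_mono fun M hM => ?_).trans (measure_norm_rowGramSchmidt_lt_le_pow hν i)
      refine lt_of_lt_of_le (show ‖rowGramSchmidt M i‖ < η from hM) ?_
      rw [hη]
      gcongr
      nlinarith
    · rw [zero_add]
      exact measure_norm_rowGramSchmidt_lt_regularRows hν hN hN0 (not_lt.1 h) k
  have hsub : {M | ∃ i, ‖rowGramSchmidt M i‖ < η} ⊆
      sparseBad n m N (n - L) ∪ {M | ∀ i : Fin n, (i : ℕ) < n - L → ∀ j, |M i j| ≤ K}ᶜ ∪
      ⋃ i : Fin n, if (i : ℕ) < n - L then {M | ‖rowGramSchmidt M i‖ < η} else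
        regularRows n m N (n - L) K ∩ {M | ‖rowGramSchmidt M i‖ < η} := by
    rintro M ⟨i, hi⟩
    by_cases h1 : M ∈ regularRows n m N (n - L) K
    · refine Or.inr (Set.mem_iUnion.2 ⟨i, ?_⟩)
      split_ifs
      · exact hi
      · exact ⟨h1, hi⟩
    · left
      by_contra h2
      simp only [Set.mem_union, not_or, Set.mem_compl_iff, not_not] at h2
      exact h1 ⟨h2.1, h2.2⟩
  have hsum : ∑ i : Fin n, ((if (i : ℕ) < n - L then p ^ (n - i : ℕ) else 0) +
        if (i : ℕ) < n - L then 0 else β) ≤ p ^ L / (1 - p) + L * β := by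
    rw [Finset.sum_add_distrib]
    refine add_le_add (sum_pow_sub_le hp0 hp1 L) ?_
    rw [Finset.sum_ite, Finset.sum_const_zero, zero_add, Finset.sum_const, nsmul_eq_mul]
    refine mul_le_mul_of_nonneg_right ?_ hβ0
    have h1 := Finset.card_filter_add_card_filter_not (s := (Finset.univ : Finset (Fin n)))
      (fun i : Fin n => (i : ℕ) < n - L)
    rw [Fin.card_filter_val_lt, Finset.card_univ, Fintype.card_fin] at h1
    have : (Finset.univ.filter fun i : Fin n => ¬ (i : ℕ) < n - L).card ≤ L := by omega
    exact_mod_cast this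
  have hsp : μ (sparseBad n m N (n - L)) ≤
      ENNReal.ofReal ((n : ℝ) ^ m * (2 * N + 1) ^ m * (1 - 1 / (8 * K ^ 2 + 1)) ^ (n - L)) := by
    refine (measure_sparseBad_le (Nat.sub_le _ _) hν).trans (le_of_eq ?_)
    rw [ENNReal.ofReal_mul (by positivity), ENNReal.ofReal_mul (by positivity),
      ENNReal.ofReal_pow (by positivity), ENNReal.ofReal_pow (by positivity),
      ENNReal.ofReal_pow hr0, ENNReal.ofReal_natCast]
    congr 3
    rw [ENNReal.ofReal_add (by positivity) zero_le_one, ENNReal.ofReal_mul zero_le_two]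
    simp
  have hS1 : 0 ≤ (n : ℝ) ^ m * (2 * N + 1) ^ m * (1 - 1 / (8 * K ^ 2 + 1)) ^ (n - L) := by
    positivity
  have hS2 : 0 ≤ p ^ L / (1 - p) + L * β := by
    have : 0 < 1 - p := by linarith
    positivity
  calc μ {M | ∃ i, ‖rowGramSchmidt M i‖ < η} ≤ _ := measure_mono hsub
    _ ≤ μ (sparseBad n m N (n - L)) + 0 + ∑ i : Fin n, ENNReal.ofReal
        ((if (i : ℕ) < n - L then p ^ (n - i : ℕ) else 0) + if (i : ℕ) < n - L then 0 else β) := by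
        refine (measure_union_le _ _).trans (add_le_add ?_ ?_)
        · exact (measure_union_le _ _).trans (add_le_add le_rfl hbdd.le)
        · exact (measure_iUnion_fintype_le _ _).trans (Finset.sum_le_sum fun i _ => hrow i)
    _ = μ (sparseBad n m N (n - L)) + ENNReal.ofReal (∑ i : Fin n,
        ((if (i : ℕ) < n - L then p ^ (n - i : ℕ) else 0) + if (i : ℕ) < n - L then 0 else β)) := by
        rw [add_zero, ENNReal.ofReal_sum_of_nonneg]
        intro i _
        split_ifs <;> simp [hβ0, pow_nonneg hp0]
    _ ≤ _ := by
        rw [add_assoc, ENNReal.ofReal_add hS1 hS2]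
        exact add_le_add hsp (ENNReal.ofReal_le_ofReal hsum)

theorem sum_inv_sqrt_le : ∑ i : Fin n, 1 / √((n - i : ℕ) : ℝ) ≤ 2 * √n := by
  have h : ∀ k : ℕ, ∑ i ∈ Finset.range k, 1 / √((i + 1 : ℕ) : ℝ) ≤ 2 * √k := by
    intro k
    induction k with
    | zero => simp
    | succ k ih =>
      rw [Finset.sum_range_succ]
      have h1 : 0 < √((k + 1 : ℕ) : ℝ) := Real.sqrt_pos.2 (by positivity)
      have h2 : √(k : ℝ) ^ 2 = k := Real.sq_sqrt (by positivity)
      have h3 : √((k + 1 : ℕ) : ℝ) ^ 2 = k + 1 := by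
        rw [Real.sq_sqrt (by positivity)]
        push_cast
        ring
      have h4 : 1 / √((k + 1 : ℕ) : ℝ) ≤ 2 * √((k + 1 : ℕ) : ℝ) - 2 * √k := by
        rw [div_le_iff₀ h1]
        nlinarith [sq_nonneg (√((k + 1 : ℕ) : ℝ) - √k)]
      linarith
  rw [Fin.sum_univ_eq_sum_range (fun i => 1 / √((n - i : ℕ) : ℝ)) n,
    ← Finset.sum_range_reflect]
  refine le_trans (le_of_eq (Finset.sum_congr rfl fun i hi => ?_)) (h n)
  have := Finset.mem_range.1 hi
  congr 4
  omega

/-- Total relative deficiency of the squared lengths of the Gram-Schmidt vectors. -/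
noncomputable def deficiency (M : Fin n → Fin n → ℝ) : ENNReal :=
  ∑ i, ENNReal.ofReal (1 - ‖rowGramSchmidt M i‖ ^ 2 / ((n - i : ℕ) : ℝ))

theorem measurable_deficiency : Measurable (deficiency (n := n)) :=
  Finset.measurable_sum _ fun i _ =>
    ((((measurable_rowGramSchmidt i).norm.pow_const 2).div_const _).const_sub 1).ennreal_ofReal

theorem measure_deficiency_ge_le (hν : ∀ i j, IsStdBounded K (ν i j)) {t : ℝ} (ht : 0 < t) :
    Measure.pi (fun i => Measure.pi (ν i)) {M | ENNReal.ofReal t ≤ deficiency M} ≤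
      ENNReal.ofReal ((K ^ 2 + 1) * (2 * √n) / t) := by
  have h1 : ∫⁻ M, deficiency M ∂Measure.pi (fun i => Measure.pi (ν i)) ≤
      ENNReal.ofReal ((K ^ 2 + 1) * (2 * √n)) := by
    unfold deficiency
    rw [lintegral_finsetSum _ fun i _ => ((((measurable_rowGramSchmidt i).norm.pow_const
      2).div_const _).const_sub 1).ennreal_ofReal]
    calc _ ≤ ∑ i : Fin n, ENNReal.ofReal ((K ^ 2 + 1) / √((n - i : ℕ) : ℝ)) :=
          Finset.sum_le_sum fun i _ => lintegral_one_sub_norm_sq_le hν i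
      _ = ENNReal.ofReal (∑ i : Fin n, (K ^ 2 + 1) / √((n - i : ℕ) : ℝ)) :=
          (ENNReal.ofReal_sum_of_nonneg fun i _ => by positivity).symm
      _ ≤ _ := by
          refine ENNReal.ofReal_le_ofReal ?_
          simp_rw [div_eq_mul_one_div (K ^ 2 + 1)]
          rw [← Finset.mul_sum]
          exact mul_le_mul_of_nonneg_left sum_inv_sqrt_le (by positivity)
  have h2 := meas_ge_le_lintegral_div (μ := Measure.pi (fun i => Measure.pi (ν i)))
    (measurable_deficiency (n := n)).aemeasurable (ε := ENNReal.ofReal t)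
    (by simpa using ht) ENNReal.ofReal_ne_top
  refine h2.trans ?_
  rw [ENNReal.ofReal_div_of_pos ht]
  gcongr

end RowBounds

theorem exp_neg_mul_max_le {a y : ℝ} (ha : 0 < a) (ha1 : a ≤ 1) (hy : a ≤ y) :
    Real.exp (-((2 * Real.log (1 / a) + 2) * max 0 (1 - y))) ≤ y := by
  have hy0 : 0 < y := ha.trans_le hy
  have hlog : 0 ≤ Real.log (1 / a) := Real.log_nonneg (by rw [one_div]; exact (one_le_inv₀ ha).2 ha1)
  rw [← Real.le_log_iff_exp_le hy0]
  rcases le_or_gt 1 y with h1 | h1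
  · rw [max_eq_left (by linarith)]
    simpa using Real.log_nonneg h1
  · rw [max_eq_right (by linarith)]
    have h3 : 0 ≤ Real.log (1 / a) * (1 - y) := mul_nonneg hlog (by linarith)
    rcases le_or_gt (1 / 2) y with h2 | h2
    · have h4 : 1 - y⁻¹ ≤ Real.log y := Real.one_sub_inv_le_log_of_pos hy0
      have h5 : -(2 * (1 - y)) ≤ 1 - y⁻¹ := by
        have e : 1 - y⁻¹ + 2 * (1 - y) = (1 - y) * (2 * y - 1) / y := by field_simp; ring
        have : 0 ≤ (1 - y) * (2 * y - 1) / y :=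
          div_nonneg (mul_nonneg (by linarith) (by linarith)) hy0.le
        linarith
      nlinarith
    · have h4 : Real.log a ≤ Real.log y := Real.log_le_log ha hy
      rw [one_div, Real.log_inv] at *
      nlinarith

theorem factorial_eq_prod_sub (n : ℕ) : (n ! : ℝ) = ∏ i : Fin n, ((n - i : ℕ) : ℝ) := by
  rw [Fin.prod_univ_eq_prod_range (fun i => ((n - i : ℕ) : ℝ)) n, ← Finset.prod_range_reflect,
    ← Finset.prod_range_add_one_eq_factorial]
  push_cast
  refine Finset.prod_congr rfl fun i hi => ?_
  have := Finset.mem_range.1 hi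
  rw [show n - (n - 1 - i) = i + 1 by omega]
  push_cast
  rfl

/-- A lower bound for the determinant in terms of the smallest Gram-Schmidt length and the
deficiency. -/
theorem sqrt_factorial_mul_exp_le_abs_det {n : ℕ} {M : Fin n → Fin n → ℝ} {a t : ℝ} (ha : 0 < a)
    (ha1 : a ≤ 1) (ht : 0 ≤ t) (hM : ∀ i, a * n ≤ ‖rowGramSchmidt M i‖ ^ 2)
    (hdef : deficiency M ≤ ENNReal.ofReal t) :
    √(n ! : ℝ) * Real.exp (-((Real.log (1 / a) + 1) * t)) ≤ |(Matrix.of M).det| := by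
  have hn : ∀ i : Fin n, (0 : ℝ) < n := fun i => by exact_mod_cast i.pos
  have hd : ∀ i : Fin n, (0 : ℝ) < ((n - i : ℕ) : ℝ) := fun i => by
    have := i.2
    exact_mod_cast (by omega : 0 < n - (i : ℕ))
  have hpos : ∀ i, 0 < ‖rowGramSchmidt M i‖ := by
    intro i
    have h1 : 0 < ‖rowGramSchmidt M i‖ ^ 2 := (mul_pos ha (hn i)).trans_le (hM i)
    exact (norm_nonneg _).lt_of_ne fun h => by simp [← h] at h1
  rw [abs_det_eq_prod_norm_rowGramSchmidt hpos]
  set B := 2 * Real.log (1 / a) + 2 with hB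
  have hB0 : 0 ≤ B := by
    have : 0 ≤ Real.log (1 / a) := Real.log_nonneg (by rw [one_div]; exact (one_le_inv₀ ha).2 ha1)
    linarith
  set Y : Fin n → ℝ := fun i => ‖rowGramSchmidt M i‖ ^ 2 / ((n - i : ℕ) : ℝ) with hY
  have hYa : ∀ i, a ≤ Y i := by
    intro i
    rw [hY, le_div_iff₀ (hd i)]
    refine le_trans ?_ (hM i)
    have : ((n - i : ℕ) : ℝ) ≤ n := by exact_mod_cast Nat.sub_le _ _
    gcongr
  have hsum : ∑ i, max 0 (1 - Y i) ≤ t := by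
    have h1 : deficiency M = ENNReal.ofReal (∑ i, max 0 (1 - Y i)) := by
      rw [ENNReal.ofReal_sum_of_nonneg fun i _ => le_max_left _ _]
      refine Finset.sum_congr rfl fun i _ => ?_
      rw [ENNReal.ofReal_max, ENNReal.ofReal_zero]
      simp [hY]
    rw [h1] at hdef
    exact (ENNReal.ofReal_le_ofReal_iff ht).1 hdef
  have hprod : Real.exp (-(B * t)) ≤ ∏ i, Y i := by
    calc Real.exp (-(B * t)) ≤ Real.exp (∑ i, -(B * max 0 (1 - Y i))) := by
          rw [Finset.sum_neg_distrib, ← Finset.mul_sum]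
          gcongr
      _ = ∏ i, Real.exp (-(B * max 0 (1 - Y i))) := Real.exp_sum _ _
      _ ≤ ∏ i, Y i := Finset.prod_le_prod (fun i _ => (Real.exp_pos _).le)
          fun i _ => exp_neg_mul_max_le ha ha1 (hYa i)
  have hprod2 : ∏ i, Y i = (∏ i, ‖rowGramSchmidt M i‖) ^ 2 / (n ! : ℝ) := by
    rw [hY, Finset.prod_div_distrib, Finset.prod_pow, factorial_eq_prod_sub]
  refine le_of_sq_le_sq ?_ (Finset.prod_nonneg fun i _ => norm_nonneg _)
  have hf : (0 : ℝ) < (n ! : ℝ) := by exact_mod_cast n.factorial_pos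
  rw [hprod2, le_div_iff₀ hf] at hprod
  rw [mul_pow, Real.sq_sqrt hf.le, ← Real.exp_nat_mul]
  refine le_trans (le_of_eq ?_) hprod
  rw [mul_comm]
  congr 2
  rw [hB]
  push_cast
  ring

section Asymptotics

theorem tendsto_sparse_bound {p C : ℝ} (hp0 : 0 < p) (hp1 : p < 1) (m L : ℕ) :
    Tendsto (fun n : ℕ => (n : ℝ) ^ m * C * p ^ (n - L)) atTop (𝓝 0) := by
  have h1 := (tendsto_pow_const_mul_const_pow_of_lt_one m hp0.le hp1).mul_const (C / p ^ L)
  rw [zero_mul] at h1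
  refine h1.congr' ?_
  filter_upwards [eventually_ge_atTop L] with n hn
  rw [pow_sub₀ p hp0.ne' hn]
  ring

theorem tendsto_deficiency_bound {ε : ℝ} (hε : 0 < ε) (C : ℝ) :
    Tendsto (fun n : ℕ => C * (2 * √n) / (n : ℝ) ^ (1 / 2 + ε / 2)) atTop (𝓝 0) := by
  have h1 : Tendsto (fun n : ℕ => (2 * C) * (n : ℝ) ^ (-(ε / 2))) atTop (𝓝 0) := by
    have := ((tendsto_rpow_neg_atTop (half_pos hε)).comp tendsto_natCast_atTop_atTop).const_mul
      (2 * C)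
    simpa using this
  refine h1.congr' ?_
  filter_upwards [eventually_gt_atTop 0] with n hn
  have hn' : (0 : ℝ) < n := by exact_mod_cast hn
  rw [Real.rpow_add hn', Real.sqrt_eq_rpow, Real.rpow_neg hn'.le]
  have := Real.rpow_pos_of_pos hn' (1 / 2)
  field_simp

theorem eventually_log_le_rpow {c ε : ℝ} (hc : 0 < c) (hε : 0 < ε) :
    ∀ᶠ n : ℕ in atTop, Real.log (1 / (1 / (c * (n : ℝ) ^ 4))) + 1 ≤ (n : ℝ) ^ (ε / 2) := by
  have h1 : Tendsto (fun x : ℝ => (Real.log c + 1) / x ^ (ε / 2) + 4 * (Real.log x / x ^ (ε / 2)))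
      atTop (𝓝 0) := by
    have e1 := (tendsto_rpow_atTop (half_pos hε)).const_div_atTop (Real.log c + 1)
    have e2 := ((isLittleO_log_rpow_atTop (half_pos hε)).tendsto_div_nhds_zero).const_mul 4
    simpa using e1.add e2
  have h2 := (h1.comp tendsto_natCast_atTop_atTop).eventually_lt_const (zero_lt_one (α := ℝ))
  filter_upwards [h2, eventually_gt_atTop 0] with n hn hn0
  have hn' : (0 : ℝ) < n := by exact_mod_cast hn0
  have hr := Real.rpow_pos_of_pos hn' (ε / 2)
  simp only [Function.comp] at hn
  rw [one_div_one_div, Real.log_mul hc.ne' (by positivity), Real.log_pow]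
  have h3 : (Real.log c + 1) / (n : ℝ) ^ (ε / 2) + 4 * (Real.log n / (n : ℝ) ^ (ε / 2)) =
      (Real.log c + 1 + 4 * Real.log n) / (n : ℝ) ^ (ε / 2) := by ring
  rw [h3, div_lt_one hr] at hn
  push_cast
  linarith

theorem exists_codim_threshold {p κ : ℝ} (hp0 : 0 ≤ p) (hp1 : p < 1) (hκ : 0 < κ) :
    ∃ L : ℕ, p ^ L / (1 - p) ≤ κ := by
  have h := (tendsto_pow_atTop_nhds_zero_of_lt_one hp0 hp1).div_const (1 - p)
  rw [zero_div] at h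
  exact (h.eventually_le_const hκ).exists

theorem exists_littlewoodOfford_params {p κ : ℝ} (hp0 : 0 ≤ p) (hp1 : p < 1) (hκ : 0 < κ) :
    ∃ k m : ℕ, 1 / √((k : ℝ) + 1) + 2 ^ k * p ^ m ≤ κ := by
  have h1 : Tendsto (fun k : ℕ => 1 / √((k : ℝ) + 1)) atTop (𝓝 0) :=
    (Real.tendsto_sqrt_atTop.comp
      (tendsto_atTop_add_const_right _ 1 tendsto_natCast_atTop_atTop)).const_div_atTop 1
  obtain ⟨k, hk⟩ := (h1.eventually_le_const (half_pos hκ)).exists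
  have h2 := (tendsto_pow_atTop_nhds_zero_of_lt_one hp0 hp1).const_mul ((2 : ℝ) ^ k)
  rw [mul_zero] at h2
  obtain ⟨m, hm⟩ := (h2.eventually_le_const (half_pos hκ)).exists
  exact ⟨k, m, by linarith⟩

/-- The lower bound for determinants of matrices with independent rows and entries. -/
theorem eventually_measureReal_det_ge {K ε κ : ℝ} (hK : 1 ≤ K) (hε : 0 < ε) (hκ : 0 < κ) :
    ∀ᶠ n : ℕ in atTop, ∀ ν : Fin n → Fin n → Measure ℝ,
      (∀ i j, IsProbabilityMeasure (ν i j)) → (∀ i j, IsStdBounded K (ν i j)) →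
      1 - κ ≤ (Measure.pi fun i => Measure.pi (ν i)).real
        {M | √(n ! : ℝ) * Real.exp (-(n : ℝ) ^ (1 / 2 + ε)) ≤ |(Matrix.of M).det|} := by
  have hκ4 : 0 < κ / 4 := by positivity
  obtain ⟨L, hL⟩ : ∃ L : ℕ, (1 - 3 / (8 * K ^ 2)) ^ L / (1 - (1 - 3 / (8 * K ^ 2))) ≤ κ / 4 := by
    refine exists_codim_threshold ?_ ?_ hκ4
    · rw [sub_nonneg, div_le_one (by positivity)]
      nlinarith
    · have : 0 < 3 / (8 * K ^ 2) := by positivity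
      linarith
  obtain ⟨k, m, hkm⟩ : ∃ k m : ℕ, 1 / √((k : ℝ) + 1) + 2 ^ k * (1 - 3 / (16 * K ^ 2)) ^ m ≤
      κ / 4 / (L + 1) := by
    refine exists_littlewoodOfford_params ?_ ?_ (by positivity)
    · rw [sub_nonneg, div_le_one (by positivity)]
      nlinarith
    · have : 0 < 3 / (16 * K ^ 2) := by positivity
      linarith
  set N : ℕ := ⌈4 * K * m⌉₊ + 1 with hN
  have hN1 : 4 * K * m ≤ N := by
    rw [hN]
    push_cast
    linarith [Nat.le_ceil (4 * K * m)]
  have hp0 : 0 < 1 - 1 / (8 * K ^ 2 + 1) := by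
    rw [sub_pos, div_lt_one (by positivity)]
    nlinarith
  have hp1 : 1 - 1 / (8 * K ^ 2 + 1) < 1 := by
    have : 0 < 1 / (8 * K ^ 2 + 1) := by positivity
    linarith
  filter_upwards [(tendsto_sparse_bound (C := (2 * N + 1) ^ m) hp0 hp1 m L).eventually_le_const hκ4,
    (tendsto_deficiency_bound hε (K ^ 2 + 1)).eventually_le_const hκ4,
    eventually_log_le_rpow (c := 256 * K ^ 2) (by positivity) hε, eventually_gt_atTop 0]
    with n h1 h2 h3 hn0 ν hprob hν
  have hn : (1 : ℝ) ≤ n := by exact_mod_cast hn0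
  have hn' : (0 : ℝ) < n := by linarith
  set μ := Measure.pi fun i => Measure.pi (ν i) with hμ
  set t := (n : ℝ) ^ (1 / 2 + ε / 2) with ht
  have ht0 : 0 < t := Real.rpow_pos_of_pos hn' _
  have hU1 : μ.real {M | ∃ i, ‖rowGramSchmidt M i‖ < 1 / (16 * K * n * √n)} ≤ 3 * (κ / 4) := by
    refine ENNReal.toReal_le_of_le_ofReal (by positivity)
      ((measure_exists_norm_rowGramSchmidt_lt_le hν hK hN1 (Nat.succ_pos _) k (L := L)).trans
        (ENNReal.ofReal_le_ofReal ?_))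
    have : (L : ℝ) * (1 / √((k : ℝ) + 1) + 2 ^ k * (1 - 3 / (16 * K ^ 2)) ^ m) ≤ κ / 4 := by
      calc _ ≤ (L : ℝ) * (κ / 4 / (L + 1)) := by gcongr
        _ = κ / 4 * (L / (L + 1)) := by ring
        _ ≤ κ / 4 * 1 := by
          gcongr
          rw [div_le_one (by positivity)]
          linarith
        _ = κ / 4 := mul_one _
    linarith
  have hU2 : μ.real {M | ENNReal.ofReal t ≤ deficiency M} ≤ κ / 4 :=
    ENNReal.toReal_le_of_le_ofReal hκ4.le
      ((measure_deficiency_ge_le hν ht0).trans (ENNReal.ofReal_le_ofReal h2))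
  have hcover : (Set.univ : Set (Fin n → Fin n → ℝ)) ⊆
      {M | √(n ! : ℝ) * Real.exp (-(n : ℝ) ^ (1 / 2 + ε)) ≤ |(Matrix.of M).det|} ∪
      ({M | ∃ i, ‖rowGramSchmidt M i‖ < 1 / (16 * K * n * √n)} ∪
        {M | ENNReal.ofReal t ≤ deficiency M}) := by
    intro M _
    by_contra hnot
    simp only [Set.mem_union, Set.mem_ofPred_eq, not_or, not_exists, not_lt, not_le] at hnot
    obtain ⟨hlt, hgs, hdef⟩ := hnot
    refine absurd hlt (not_lt.2 (le_trans ?_ (sqrt_factorial_mul_exp_le_abs_det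
      (a := 1 / (256 * K ^ 2 * (n : ℝ) ^ 4)) (t := t) (by positivity) ?_ ht0.le ?_ hdef.le)))
    · gcongr
      calc _ ≤ (n : ℝ) ^ (ε / 2) * t := by gcongr
        _ = (n : ℝ) ^ (1 / 2 + ε) := by
          rw [ht, ← Real.rpow_add hn']
          congr 1
          ring
    · rw [div_le_one (by positivity)]
      have e1 : 1 ≤ K ^ 2 := one_le_pow₀ hK
      have e2 : 1 ≤ (n : ℝ) ^ 4 := one_le_pow₀ hn
      nlinarith
    · intro i
      refine le_trans (le_of_eq ?_) (pow_le_pow_left₀ (by positivity) (hgs i) 2)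
      rw [div_pow, mul_pow, mul_pow, mul_pow, Real.sq_sqrt hn'.le]
      field_simp
      norm_num
  have h4 := (measureReal_mono hcover).trans ((measureReal_union_le (μ := μ) _ _).trans
    (add_le_add le_rfl (measureReal_union_le _ _)))
  rw [probReal_univ] at h4
  linarith

end Asymptotics

/-- The law of a matrix with independent entries is the iterated product of the entry laws. -/
theorem map_eq_pi_pi_of_iIndepFun {n : ℕ} {Ω : Type*} [MeasurableSpace Ω] {μ : Measure Ω}
    [IsProbabilityMeasure μ] {ξ : Fin n → Fin n → Ω → ℝ} (hm : ∀ i j, Measurable (ξ i j))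
    (hind : iIndepFun (fun p : Fin n × Fin n => ξ p.1 p.2) μ) :
    μ.map (fun ω i j => ξ i j ω) = Measure.pi fun i => Measure.pi fun j => μ.map (ξ i j) := by
  have hprob : ∀ i j, IsProbabilityMeasure (μ.map (ξ i j)) := fun i j =>
    Measure.isProbabilityMeasure_map (hm i j).aemeasurable
  have h1 := hind.map_fun_eq_pi_map (fun p : Fin n × Fin n => (hm p.1 p.2).aemeasurable)
  have hmu : Measurable fun (M : Fin n → Fin n → ℝ) (p : Fin n × Fin n) => M p.1 p.2 := by
    fun_prop
  have hmc : Measurable fun (x : Fin n × Fin n → ℝ) (i j : Fin n) => x (i, j) := by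
    fun_prop
  have h2 : (Measure.pi fun i => Measure.pi fun j => μ.map (ξ i j)).map
      (fun (M : Fin n → Fin n → ℝ) (p : Fin n × Fin n) => M p.1 p.2) =
      Measure.pi fun p : Fin n × Fin n => μ.map (ξ p.1 p.2) := by
    refine (Measure.pi_eq fun s hs => ?_).symm
    rw [Measure.map_apply hmu (MeasurableSet.univ_pi hs)]
    have : (fun (M : Fin n → Fin n → ℝ) (p : Fin n × Fin n) => M p.1 p.2) ⁻¹' Set.univ.pi s =
        Set.univ.pi fun i => Set.univ.pi fun j => s (i, j) := by
      ext M
      simp [Set.mem_pi]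
    rw [this, Measure.pi_pi, Fintype.prod_prod_type]
    exact Finset.prod_congr rfl fun i _ => Measure.pi_pi _ _
  have h3 := congrArg (Measure.map fun (x : Fin n × Fin n → ℝ) (i j : Fin n) => x (i, j))
    (h1.trans h2.symm)
  rw [Measure.map_map hmc (measurable_pi_lambda _ fun p => hm p.1 p.2), Measure.map_map hmc hmu]
    at h3
  exact h3.trans Measure.map_id

theorem isStdBounded_map {Ω : Type*} [MeasurableSpace Ω] {μ : Measure Ω} [IsProbabilityMeasure μ]
    {X : Ω → ℝ} {K : ℝ} (hX : Measurable X) (h0 : ∫ ω, X ω ∂μ = 0) (h1 : variance X μ = 1)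
    (hb : ∀ᵐ ω ∂μ, |X ω| ≤ K) : IsStdBounded K (μ.map X) where
  bound := (ae_map_iff hX.aemeasurable (measurableSet_le (by fun_prop) (by fun_prop))).2 hb
  mean := by
    rw [integral_map hX.aemeasurable (by fun_prop)]
    exact h0
  second := by
    rw [integral_map hX.aemeasurable (by fun_prop), ← h1,
      variance_of_integral_eq_zero hX.aemeasurable h0]

theorem theorem7p6 (K : ℝ) (ε : ℝ) (hε : 0 < ε) :
    ∃ δ : ℕ → ℝ, Tendsto δ atTop (𝓝 0) ∧
      ∀ (n : ℕ) (Ω : Type*) [MeasurableSpace Ω] (μ : Measure Ω) [IsProbabilityMeasure μ]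
        (ξ : Fin n → Fin n → Ω → ℝ),
        (∀ i j, Measurable (ξ i j)) →
        iIndepFun (fun p : Fin n × Fin n => ξ p.1 p.2) μ →
        (∀ i j, ∫ ω, ξ i j ω ∂μ = 0) →
        (∀ i j, variance (ξ i j) μ = 1) →
        (∀ i j, ∀ᵐ ω ∂μ, |ξ i j ω| ≤ K) →
        1 - δ n ≤ μ.real {ω | Real.sqrt (n ! : ℝ) * Real.exp (-(n : ℝ) ^ (1 / 2 + ε)) ≤
          |(Matrix.of fun i j => ξ i j ω).det|} := by
  set F : ℕ → Set ℝ := fun n => {r | r = 0 ∨ ∃ ν : Fin n → Fin n → Measure ℝ,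
    (∀ i j, IsProbabilityMeasure (ν i j)) ∧ (∀ i j, IsStdBounded K (ν i j)) ∧
    r = 1 - (Measure.pi fun i => Measure.pi (ν i)).real
      {M | √(n ! : ℝ) * Real.exp (-(n : ℝ) ^ (1 / 2 + ε)) ≤ |(Matrix.of M).det|}} with hF
  have hbdd : ∀ n, BddAbove (F n) := by
    refine fun n => ⟨1, ?_⟩
    rintro r (rfl | ⟨ν, -, -, rfl⟩)
    · exact zero_le_one
    · exact sub_le_self _ measureReal_nonneg
  have hzero : ∀ n, (0 : ℝ) ∈ F n := fun n => Or.inl rfl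
  refine ⟨fun n => sSup (F n), ?_, ?_⟩
  · rw [Metric.tendsto_nhds]
    intro κ hκ
    have key : ∀ᶠ n : ℕ in atTop, ∀ ν : Fin n → Fin n → Measure ℝ,
        (∀ i j, IsProbabilityMeasure (ν i j)) → (∀ i j, IsStdBounded K (ν i j)) →
        1 - κ / 2 ≤ (Measure.pi fun i => Measure.pi (ν i)).real
          {M | √(n ! : ℝ) * Real.exp (-(n : ℝ) ^ (1 / 2 + ε)) ≤ |(Matrix.of M).det|} := by
      by_cases hK : 1 ≤ K
      · exact eventually_measureReal_det_ge hK hε (half_pos hκ)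
      · filter_upwards [eventually_gt_atTop 0] with n hn ν hprob hν
        have := hprob ⟨0, hn⟩ ⟨0, hn⟩
        exact absurd (hν ⟨0, hn⟩ ⟨0, hn⟩).one_le hK
    filter_upwards [key] with n hn
    have h1 : sSup (F n) ≤ κ / 2 := by
      refine csSup_le ⟨0, hzero n⟩ ?_
      rintro r (rfl | ⟨ν, hprob, hν, rfl⟩)
      · positivity
      · linarith [hn ν hprob hν]
    rw [Real.dist_eq, sub_zero, abs_of_nonneg (le_csSup (hbdd n) (hzero n))]
    linarith
  · intro n Ω _ μ _ ξ hm hind h0 h1 hb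
    have hmap := map_eq_pi_pi_of_iIndepFun hm hind
    have hmeas : Measurable fun ω i j => ξ i j ω :=
      measurable_pi_lambda _ fun i => measurable_pi_lambda _ fun j => hm i j
    have hset : MeasurableSet {M : Fin n → Fin n → ℝ |
        √(n ! : ℝ) * Real.exp (-(n : ℝ) ^ (1 / 2 + ε)) ≤ |(Matrix.of M).det|} := by
      have : Continuous fun M : Fin n → Fin n → ℝ => |(Matrix.of M).det| :=
        (Continuous.matrix_det continuous_id).abs
      exact measurableSet_le measurable_const this.measurable
    have hmem : 1 - (Measure.pi fun i => Measure.pi fun j => μ.map (ξ i j)).real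
        {M | √(n ! : ℝ) * Real.exp (-(n : ℝ) ^ (1 / 2 + ε)) ≤ |(Matrix.of M).det|} ∈ F n :=
      Or.inr ⟨fun i j => μ.map (ξ i j),
        fun i j => Measure.isProbabilityMeasure_map (hm i j).aemeasurable,
        fun i j => isStdBounded_map (hm i j) (h0 i j) (h1 i j) (hb i j), rfl⟩
    have h2 := le_csSup (hbdd n) hmem
    rw [← hmap, map_measureReal_apply hmeas hset] at h2
    have h3 : (fun ω i j => ξ i j ω) ⁻¹' {M : Fin n → Fin n → ℝ |
        √(n ! : ℝ) * Real.exp (-(n : ℝ) ^ (1 / 2 + ε)) ≤ |(Matrix.of M).det|} =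
        {ω | √(n ! : ℝ) * Real.exp (-(n : ℝ) ^ (1 / 2 + ε)) ≤
          |(Matrix.of fun i j => ξ i j ω).det|} := rfl
    rw [h3] at h2
    linarith
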